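/- Let $G$ be a connected undirected graph on the nodes $\mathcal N=\{1,\dots,N\}$, $N\ge 2$. Write $x\sim y$ if $x=y$ or $x,y$ are joined by an edge, and let $\mathcal E=\{(x,y): x\sim y\}$. Let $\omega:\mathcal N\times\mathcal N\to[0,\infty)$ be weights with $\omega(x,y)=\omega(y,x)$, and $\omega(x,y)>0$ if and only if $x\sim y$. Let $T$ be a map from $\mathcal E$ onto $\mathcal I=\{1,\dots,r\}$ with $T(x,y)=T(y,x)$ (edges with $T(x,y)=i$ carry the delay $\tau_i$), and put $\omega_i(x,y)=\omega(x,y)$ if $(x,y)\in\mathcal E$ and $T(x,y)=i$, and $\omega_i(x,y)=0$ otherwise. Let $d\ge1$ and let $H^1$ be the space of all functions $f:\mathcal N\to\mathbb R^d$ with $\sum_x f(x)=0$, with the norm $\|f\|_{L^2}=(\sum_x\|f(x)\|^2)^{1/2}$. On $H^1$ define $$\Delta f(x)=\sum_{y\in\mathcal N}\omega(x,y)\,(f(y)-f(x)),\qquad \Delta_i f(x)=\sum_{y\in\mathcal N}\omega_i(x,y)\,(f(y)-f(x)),\quad i\in\mathcal I,$$ and let $\|\Delta\|$ be the operator norm of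 $\Delta:H^1\to H^1$ (which equals $|\lambda_{\min}|$, where $\lambda_{\min}$ is the smallest eigenvalue of $\Delta$ on $H^1$). Let $\bar\tau\ge0$. For constant delays $\tau_i\in[0,\bar\tau]$, consider $$\dot v_1(t)=\sum_{i\in\mathcal I}\Delta_i v_1(t-\tau_i)\quad(t\ge0),\qquad v_1(t)=\varphi(t)\quad(t\in[-\bar\tau,0]),\tag{1}$$ where $\varphi:[-\bar\tau,0]\to H^1$ is continuous and solutions $v_1:[-\bar\tau,\infty)\to H^1$ are continuous and differentiable on $[0,\infty)$ (from the right at $0$). The zero solution of (1) is called globally exponentially stable if there are $M,\gamma>0$ such that, for every continuous $\varphi$, every solution of (1) satisfies $\|v_1(t)\|_{L^2}\le M e^{-\gamma t}\sup_{s\in[-\bar\tau,0]}\|\varphi(s)\|_{L^2}$ for all $t\ge 0$. Then the zero solution of (1) is globally exponentially stable for every choice of constant delays $\tau_i\in[0,\bar\tau]$, $i\in\mathcal I$, if and only if $$\bar\tau<\frac{\pi}{2\|\Delta\|}.$$ -/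

import Mathlib

noncomputable section

namespace DelayConsensus

/-- An undirected weighted graph on the nodes `Fin N`. -/
structure WeightedGraph (N : ℕ) where
  graph : SimpleGraph (Fin N)
  weight : Fin N → Fin N → ℝ
  weight_nonneg : ∀ x y, 0 ≤ weight x y
  weight_symm : ∀ x y, weight x y = weight y x
  weight_pos_iff : ∀ x y, 0 < weight x y ↔ (x = y ∨ graph.Adj x y)

/-- The neighbouring relation `x ∼ y`, for which `x ∼ x` always holds. -/
def WeightedGraph.Neighbor {N : ℕ} (G : WeightedGraph N) (x y : Fin N) : Prop :=
  x = y ∨ G.graph.Adj x y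

/-- The edge set, as a set of ordered pairs. -/
def WeightedGraph.edges {N : ℕ} (G : WeightedGraph N) : Set (Fin N × Fin N) :=
  {e | G.Neighbor e.1 e.2}

/-- A symmetric assignment of one of `r` delay classes to every edge, each class being used.
The class, not the value of the delay, is recorded: distinct classes may have equal delays. -/
structure DelayAssignment {N : ℕ} (G : WeightedGraph N) (r : ℕ) where
  toFun : G.edges → Fin r
  symm : ∀ (x y : Fin N) (h : (x, y) ∈ G.edges) (h' : (y, x) ∈ G.edges),
    toFun ⟨(x, y), h⟩ = toFun ⟨(y, x), h'⟩
  onto : Function.Surjective toFun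

open Classical in
/-- The weight of the subgraph formed by the edges of class `i`. -/
def DelayAssignment.weight {N : ℕ} {G : WeightedGraph N} {r : ℕ} (T : DelayAssignment G r)
    (i : Fin r) (x y : Fin N) : ℝ :=
  if ∃ h : (x, y) ∈ G.edges, T.toFun ⟨(x, y), h⟩ = i then G.weight x y else 0

theorem DelayAssignment.weight_symm {N : ℕ} {G : WeightedGraph N} {r : ℕ}
    (T : DelayAssignment G r) (i : Fin r) (x y : Fin N) : T.weight i x y = T.weight i y x := by
  have key : ∀ x y : Fin N, (∃ h : (x, y) ∈ G.edges, T.toFun ⟨(x, y), h⟩ = i) →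
      ∃ h : (y, x) ∈ G.edges, T.toFun ⟨(y, x), h⟩ = i := by
    rintro x y ⟨h, hi⟩
    have h' : (y, x) ∈ G.edges := h.elim (fun e => Or.inl e.symm) (fun e => Or.inr e.symm)
    exact ⟨h', by rw [← hi, T.symm x y h h']⟩
  unfold DelayAssignment.weight
  rw [G.weight_symm x y]
  by_cases h : ∃ h : (x, y) ∈ G.edges, T.toFun ⟨(x, y), h⟩ = i
  · rw [if_pos h, if_pos (key x y h)]
  · rw [if_neg h, if_neg fun h' => h (key y x h')]

/-- Functions from the nodes to `ℝ^d`, with the scalar product `∑ x, f x ⬝ g x`. -/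
def L2 (N d : ℕ) : Type := PiLp 2 (fun _ : Fin N => EuclideanSpace ℝ (Fin d))

namespace L2

instance (N d : ℕ) : NormedAddCommGroup (L2 N d) :=
  inferInstanceAs (NormedAddCommGroup (PiLp 2 (fun _ : Fin N => EuclideanSpace ℝ (Fin d))))

instance (N d : ℕ) : InnerProductSpace ℝ (L2 N d) :=
  inferInstanceAs (InnerProductSpace ℝ (PiLp 2 (fun _ : Fin N => EuclideanSpace ℝ (Fin d))))

instance (N d : ℕ) : FiniteDimensional ℝ (L2 N d) :=
  inferInstanceAs (FiniteDimensional ℝ (PiLp 2 (fun _ : Fin N => EuclideanSpace ℝ (Fin d))))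

instance (N d : ℕ) : CoeFun (L2 N d) (fun _ => Fin N → EuclideanSpace ℝ (Fin d)) :=
  ⟨fun f => WithLp.ofLp f⟩

/-- The element of `L2 N d` with the given values. -/
def of {N d : ℕ} (f : Fin N → EuclideanSpace ℝ (Fin d)) : L2 N d := WithLp.toLp 2 f

variable {N d : ℕ}

@[ext] theorem ext {f g : L2 N d} (h : ∀ x, f x = g x) : f = g := PiLp.ext h

@[simp] theorem of_apply (f : Fin N → EuclideanSpace ℝ (Fin d)) (x : Fin N) : of f x = f x := rfl

@[simp] theorem zero_apply (x : Fin N) : (0 : L2 N d) x = 0 := rfl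

@[simp] theorem add_apply (f g : L2 N d) (x : Fin N) : (f + g) x = f x + g x := rfl

@[simp] theorem smul_apply (c : ℝ) (f : L2 N d) (x : Fin N) : (c • f) x = c • f x := rfl

theorem inner_eq (f g : L2 N d) : inner ℝ f g = ∑ x, inner ℝ (f x) (g x) := rfl

theorem norm_sq_eq (f : L2 N d) : ‖f‖ ^ 2 = ∑ x, ‖f x‖ ^ 2 := PiLp.norm_sq_eq_of_L2 _ f

end L2

/-- The functions with zero average, with the norm inherited from `L2 N d`. -/
def H1 (N d : ℕ) : Submodule ℝ (L2 N d) where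
  carrier := {f | ∑ x, f x = 0}
  add_mem' {f g} hf hg := by
    change ∑ x, f x = 0 at hf
    change ∑ x, g x = 0 at hg
    change ∑ x, (f + g) x = 0
    simp [Finset.sum_add_distrib, hf, hg]
  zero_mem' := by
    change ∑ x, (0 : L2 N d) x = 0
    simp
  smul_mem' c f hf := by
    change ∑ x, f x = 0 at hf
    change ∑ x, (c • f) x = 0
    simp [← Finset.smul_sum, hf]

/-- The Laplacian `(Δ f)(x) = ∑ y, w(x,y) (f(y) - f(x))` with weights `w`. -/
def lap {N : ℕ} (w : Fin N → Fin N → ℝ) (d : ℕ) : L2 N d →ₗ[ℝ] L2 N d where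
  toFun f := L2.of fun x => ∑ y, w x y • (f y - f x)
  map_add' f g := by
    ext1 x
    simp only [L2.of_apply, L2.add_apply, ← Finset.sum_add_distrib]
    refine Finset.sum_congr rfl fun y _ => ?_
    module
  map_smul' c f := by
    ext1 x
    simp only [L2.of_apply, L2.smul_apply, RingHom.id_apply, Finset.smul_sum]
    refine Finset.sum_congr rfl fun y _ => ?_
    module

theorem lap_apply {N : ℕ} (w : Fin N → Fin N → ℝ) (d : ℕ) (f : L2 N d) (x : Fin N) :
    lap w d f x = ∑ y, w x y • (f y - f x) := rfl

theorem lap_mem_H1 {N : ℕ} (w : Fin N → Fin N → ℝ) (hw : ∀ x y, w x y = w y x) (d : ℕ)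
    (f : L2 N d) : lap w d f ∈ H1 N d := by
  change ∑ x, ∑ y, w x y • (f y - f x) = 0
  have h : ∑ x, ∑ y, w x y • (f y - f x) = -∑ x, ∑ y, w x y • (f y - f x) := by
    conv_lhs => rw [Finset.sum_comm]
    simp only [← Finset.sum_neg_distrib]
    refine Finset.sum_congr rfl fun x _ => Finset.sum_congr rfl fun y _ => ?_
    rw [hw y x]
    module
  have h2 : (2 : ℝ) • ∑ x, ∑ y, w x y • (f y - f x) = 0 := by
    rw [two_smul]
    exact add_eq_zero_iff_eq_neg.mpr h
  exact (smul_eq_zero.mp h2).resolve_left two_ne_zero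

/-- The Laplacian with symmetric weights `w` as an operator from `H1` to `H1`. -/
def lapH1 {N : ℕ} (w : Fin N → Fin N → ℝ) (hw : ∀ x y, w x y = w y x) (d : ℕ) :
    H1 N d →L[ℝ] H1 N d :=
  LinearMap.toContinuousLinearMap ((lap w d).restrict (p := H1 N d) (q := H1 N d)
    fun f _ => lap_mem_H1 w hw d f)

/-- The Laplacian `Δ` of the graph, on `H1`. -/
def WeightedGraph.laplacian {N : ℕ} (G : WeightedGraph N) (d : ℕ) : H1 N d →L[ℝ] H1 N d :=
  lapH1 G.weight G.weight_symm d

/-- The Laplacian `Δᵢ` of the subgraph formed by the edges of class `i`, on `H1`. -/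
def DelayAssignment.laplacian {N : ℕ} {G : WeightedGraph N} {r : ℕ} (T : DelayAssignment G r)
    (d : ℕ) (i : Fin r) : H1 N d →L[ℝ] H1 N d :=
  lapH1 (T.weight i) (T.weight_symm i) d

/-- `v` is a solution of `v'(t) = ∑ i, A i (v (t - τ i))`, `t ≥ 0`, with initial condition `φ`
on `[-h, 0]`. At `t = 0` the derivative is the right derivative. The values of `φ` outside
`[-h, 0]` and those of `v` before `-h` play no role. -/
def IsDelaySolution {E : Type*} [NormedAddCommGroup E] [NormedSpace ℝ E] {r : ℕ}
    (A : Fin r → E →L[ℝ] E) (τ : Fin r → ℝ) (h : ℝ) (φ v : ℝ → E) : Prop :=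
  Set.EqOn v φ (Set.Icc (-h) 0) ∧
  ContinuousOn v (Set.Ici (-h)) ∧
  ∀ t : ℝ, 0 ≤ t → HasDerivWithinAt v (∑ i, A i (v (t - τ i))) (Set.Ici 0) t

/-- The zero solution of `v'(t) = ∑ i, A i (v (t - τ i))` is globally exponentially stable, with
respect to all continuous initial conditions on `[-h, 0]` and their supremum norm. -/
def IsGloballyExpStable {E : Type*} [NormedAddCommGroup E] [NormedSpace ℝ E] {r : ℕ}
    (A : Fin r → E →L[ℝ] E) (τ : Fin r → ℝ) (h : ℝ) : Prop :=
  ∃ M γ : ℝ, 0 < M ∧ 0 < γ ∧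
    ∀ φ : ℝ → E, ContinuousOn φ (Set.Icc (-h) 0) →
      ∀ v : ℝ → E, IsDelaySolution A τ h φ v →
        ∀ t : ℝ, 0 ≤ t →
          ‖v t‖ ≤ M * Real.exp (-γ * t) * sSup ((fun s => ‖φ s‖) '' Set.Icc (-h) 0)

end DelayConsensus

end

/-!
Let `λ = ‖Δ‖`, so that `-λ` is the smallest eigenvalue of `Δ`.

*Necessity.* If the bound on the delays allows the common delay `π / (2λ)` and `Δ f = -λ f`, then
`cos (λ t) f` solves the equation, because a delay by `π / (2λ)` turns `cos (λ t)` into `sin (λ t)`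
(`not_isGloballyExpStable_of_eigenvector`, `exists_eigenvector_neg_norm`).

*Sufficiency.* The operators `Δᵢ` are symmetric and negative semidefinite, and `μ ≤ -∑ᵢ Δᵢ ≤ λ` as
quadratic forms, with `μ > 0` by connectivity (`DelayAssignment.exists_isDissipative`). Testing the
characteristic equation with `û` reduces it to the scalar `z + ∑ᵢ Qᵢ exp (-z τᵢ)` with `Qᵢ ≥ 0` and
`μ ≤ ∑ᵢ Qᵢ ≤ λ`. For `Re z ≥ 0` it is bounded away from zero: either `|Im z|` exceeds `λ` by a
margin, or all angles `τᵢ Im z` stay below `π / 2` and the real part is positive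
(`exists_symbol_bound`).

Instead of inverting a Laplace transform, the symbol bound is used through Plancherel's theorem: the
operators `w ↦ w' + σ w - ∑ᵢ exp (-σ τᵢ) Δᵢ w(· - τᵢ)` are bounded below in `L²(ℝ)`, uniformly in
`σ ≥ 0` (`IsDissipative.exists_L2_bound`). A smooth cutoff turns a solution into a solution `u` of a
forced equation with zero history and compactly supported forcing. If `u` grows at most like
`exp (σ t)`, multiply it by `exp (-σ t) ψ(t)` with `ψ = 1 / (exp (-ε t) + δ exp (ε t))`. As
`log ψ` varies at rate at most `ε`, the error made in the equation is a small multiple of the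
weighted function and is absorbed by the `L²` bound; letting `δ → 0` gives growth at most
`exp ((σ - ε) t)` (`IsForcedSolution.weighted_bound`). Since `ε` does not depend on `σ`, finitely
many such steps lead from the a priori exponential bound to the exponent `-ε`
(`IsDissipative.exists_decay`), where the constant depends on the coefficients only.

Only real vector spaces appear: the Fourier transform of a function with values in `E` is the pair
of its cosine and sine transforms.
-/

noncomputable section

open MeasureTheory Real SchwartzMap FourierTransform Topology Filter

namespace DelayConsensus

section

/-! ### Plancherel's theorem for the cosine and the sine transform -/

/-- Plancherel's theorem for the Fourier integral of a scalar function in `L¹ ∩ L²`. The Fourier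
integral agrees almost everywhere with the `L²` Fourier transform, since both define the same
tempered distribution. -/
theorem plancherel_complex {f : ℝ → ℂ} (h1 : Integrable f) (h2 : MemLp f 2) :
    MemLp (𝓕 f) 2 ∧ ∫ ξ, ‖𝓕 f ξ‖ ^ 2 = ∫ t, ‖f t‖ ^ 2 := by
  set F : Lp ℂ 2 (volume : Measure ℝ) := 𝓕 (h2.toLp f) with hF
  have hcont : Continuous (𝓕 f) :=
    VectorFourier.fourierIntegral_continuous (μ := volume) (L := innerₗ ℝ)
      Real.continuous_fourierChar (by exact continuous_inner) h1
  have hae : ∀ᵐ ξ, F ξ = 𝓕 f ξ := by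
    have hFloc : LocallyIntegrable F volume :=
      (Lp.memLp F).locallyIntegrable (by norm_num)
    refine ae_eq_of_integral_contDiff_smul_eq hFloc hcont.locallyIntegrable ?_
    intro g hg hgc
    have hg' : ContDiff ℝ (⊤ : ℕ∞) (fun x => (g x : ℂ)) := Complex.ofRealCLM.contDiff.comp hg
    have hgc' : HasCompactSupport (fun x => (g x : ℂ)) := hgc.comp_left Complex.ofReal_zero
    let G : 𝓢(ℝ, ℂ) := hgc'.toSchwartzMap hg'
    have hG : ∀ x, G x = (g x : ℂ) := fun x => rfl
    have key : (𝓕 ((h2.toLp f : Lp ℂ 2 (volume : Measure ℝ)) : 𝓢'(ℝ, ℂ))) G = (F : 𝓢'(ℝ, ℂ)) G := by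
      rw [Lp.fourier_toTemperedDistribution_eq]
    rw [TemperedDistribution.fourier_apply, Lp.toTemperedDistribution_apply,
      Lp.toTemperedDistribution_apply] at key
    have e1 : ∫ x, g x • F x = ∫ x, G x • F x := by
      simp [hG]
    have e2 : ∫ x, g x • 𝓕 f x = ∫ x, G x • 𝓕 f x := by
      simp [hG]
    rw [e1, e2, ← key]
    have e3 : ∫ x, (𝓕 G) x • (h2.toLp f) x = ∫ x, (𝓕 G) x • f x := by
      refine integral_congr_ae ?_
      filter_upwards [h2.coeFn_toLp] with x hx
      rw [hx]
    rw [e3]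
    have := VectorFourier.integral_fourierIntegral_smul_eq_flip (μ := volume) (ν := volume)
      (L := innerₗ ℝ) (f := (G : ℝ → ℂ)) (g := f) Real.continuous_fourierChar
      (by exact continuous_inner) G.integrable h1
    rw [flip_innerₗ] at this
    exact this
  have hmem : MemLp (𝓕 f) 2 := (Lp.memLp F).ae_eq hae
  refine ⟨hmem, ?_⟩
  have hn : ‖F‖ = ‖h2.toLp f‖ := Lp.norm_fourier_eq _
  have hsq : ∀ {k : ℝ → ℂ} (hk : MemLp k 2), ‖hk.toLp k‖ ^ 2 = ∫ t, ‖k t‖ ^ 2 := by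
    intro k hk
    have h3 := @inner_self_eq_norm_sq_to_K ℂ _ _ _ _ (hk.toLp k)
    rw [MeasureTheory.L2.inner_def] at h3
    have h4 : ∫ a, inner ℂ ((hk.toLp k) a) ((hk.toLp k) a) = ((∫ t, ‖k t‖ ^ 2 : ℝ) : ℂ) := by
      rw [← integral_complex_ofReal]
      refine integral_congr_ae ?_
      filter_upwards [hk.coeFn_toLp] with x hx
      rw [hx, inner_self_eq_norm_sq_to_K]
      norm_cast
    rw [h4] at h3
    exact Complex.ofReal_injective (by simpa using h3.symm)
  rw [← hsq hmem, ← hsq h2, ← hn]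
  congr 2
  exact (Lp.ext ((hmem.coeFn_toLp).trans (hae.mono fun x hx => hx.symm)))

variable {E : Type*} [NormedAddCommGroup E] [InnerProductSpace ℝ E]

/-- The cosine transform `∫ cos (η t) w(t) dt`, with values in the real space `E`. -/
def cosT (w : ℝ → E) (η : ℝ) : E := ∫ t, cos (η * t) • w t

/-- The sine transform `∫ sin (η t) w(t) dt`, with values in the real space `E`. -/
def sinT (w : ℝ → E) (η : ℝ) : E := ∫ t, sin (η * t) • w t

theorem integrable_cos_smul {w : ℝ → E} (hw : Integrable w) (η : ℝ) :
    Integrable fun t => cos (η * t) • w t := by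
  refine hw.bdd_smul 1 (by fun_prop) (Eventually.of_forall fun t => ?_)
  simpa using abs_cos_le_one (η * t)

theorem integrable_sin_smul {w : ℝ → E} (hw : Integrable w) (η : ℝ) :
    Integrable fun t => sin (η * t) • w t := by
  refine hw.bdd_smul 1 (by fun_prop) (Eventually.of_forall fun t => ?_)
  simpa using abs_sin_le_one (η * t)

/-- Plancherel's theorem for the pair of the cosine and the sine transform. -/
theorem plancherel_cos_sin [FiniteDimensional ℝ E] {w : ℝ → E} (h1 : Integrable w) (h2 : MemLp w 2) :
    Integrable (fun ξ => ‖cosT w (2 * π * ξ)‖ ^ 2 + ‖sinT w (2 * π * ξ)‖ ^ 2) ∧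
    ∫ ξ, (‖cosT w (2 * π * ξ)‖ ^ 2 + ‖sinT w (2 * π * ξ)‖ ^ 2) = ∫ t, ‖w t‖ ^ 2 := by
  let b := stdOrthonormalBasis ℝ E
  let x : Fin (Module.finrank ℝ E) → ℝ → ℂ := fun k t => ((inner ℝ (b k) (w t) : ℝ) : ℂ)
  have hx1 : ∀ k, Integrable (x k) := fun k => (h1.const_inner (𝕜 := ℝ) (b k)).ofReal
  have hx2 : ∀ k, MemLp (x k) 2 := fun k => (h2.const_inner (𝕜 := ℝ) (b k)).ofReal
  have hF : ∀ k ξ, 𝓕 (x k) ξ = (inner ℝ (b k) (cosT w (2 * π * ξ)) : ℝ)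
      - (inner ℝ (b k) (sinT w (2 * π * ξ)) : ℝ) * Complex.I := by
    intro k ξ
    have hc : (inner ℝ (b k) (cosT w (2 * π * ξ)) : ℝ)
        = ∫ t, cos (2 * π * ξ * t) * inner ℝ (b k) (w t) := by
      rw [cosT, ← integral_inner (integrable_cos_smul h1 _)]
      simp [inner_smul_right]
    have hs : (inner ℝ (b k) (sinT w (2 * π * ξ)) : ℝ)
        = ∫ t, sin (2 * π * ξ * t) * inner ℝ (b k) (w t) := by
      rw [sinT, ← integral_inner (integrable_sin_smul h1 _)]
      simp [inner_smul_right]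
    have hic : Integrable fun t => ((cos (2 * π * ξ * t) * inner ℝ (b k) (w t) : ℝ) : ℂ) := by
      have := (integrable_cos_smul (h1.const_inner (𝕜 := ℝ) (b k)) (2 * π * ξ)).ofReal (𝕜 := ℂ)
      exact this
    have his : Integrable fun t => ((sin (2 * π * ξ * t) * inner ℝ (b k) (w t) : ℝ) : ℂ) := by
      have := (integrable_sin_smul (h1.const_inner (𝕜 := ℝ) (b k)) (2 * π * ξ)).ofReal (𝕜 := ℂ)
      exact this
    rw [hc, hs, Real.fourier_real_eq_integral_exp_smul, ← integral_complex_ofReal,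
      ← integral_complex_ofReal, ← integral_mul_const, ← integral_sub hic (his.mul_const _)]
    refine integral_congr_ae (Eventually.of_forall fun t => ?_)
    simp only [x, smul_eq_mul]
    rw [show ((-2 * π * t * ξ : ℝ) : ℂ) * Complex.I = ((-(2 * π * ξ * t) : ℝ) : ℂ) * Complex.I by
      push_cast; ring, Complex.exp_mul_I, ← Complex.ofReal_cos, ← Complex.ofReal_sin,
      cos_neg, sin_neg]
    push_cast
    ring
  have hn : ∀ k ξ, ‖𝓕 (x k) ξ‖ ^ 2 = (inner ℝ (b k) (cosT w (2 * π * ξ))) ^ 2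
      + (inner ℝ (b k) (sinT w (2 * π * ξ))) ^ 2 := by
    intro k ξ
    rw [hF, ← Complex.normSq_eq_norm_sq, Complex.normSq_apply]
    simp
    ring
  have hsum : ∀ e : E, ‖e‖ ^ 2 = ∑ k, (inner ℝ (b k) e) ^ 2 := by
    intro e
    rw [← b.sum_sq_norm_inner_right e]
    simp
  have hpt : ∀ ξ, ‖cosT w (2 * π * ξ)‖ ^ 2 + ‖sinT w (2 * π * ξ)‖ ^ 2
      = ∑ k, ‖𝓕 (x k) ξ‖ ^ 2 := by
    intro ξ
    rw [hsum, hsum, ← Finset.sum_add_distrib]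
    exact Finset.sum_congr rfl fun k _ => (hn k ξ).symm
  have hint : ∀ k, Integrable fun ξ => ‖𝓕 (x k) ξ‖ ^ 2 := fun k =>
    (plancherel_complex (hx1 k) (hx2 k)).1.integrable_norm_pow (by norm_num)
  simp only [hpt]
  refine ⟨integrable_finsetSum _ fun k _ => hint k, ?_⟩
  rw [integral_finsetSum _ fun k _ => hint k]
  have hxint : ∀ k, Integrable fun t => ‖x k t‖ ^ 2 := fun k =>
    (hx2 k).integrable_norm_pow (by norm_num)
  have hw : ∀ t, ‖w t‖ ^ 2 = ∑ k, ‖x k t‖ ^ 2 := by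
    intro t
    rw [hsum]
    simp [x]
  simp only [hw]
  rw [integral_finsetSum _ fun k _ => hxint k]
  exact Finset.sum_congr rfl fun k _ => (plancherel_complex (hx1 k) (hx2 k)).2

end

section

variable {E : Type*} [NormedAddCommGroup E] [InnerProductSpace ℝ E]

/-! ### Rules for the cosine and the sine transform -/

theorem cosT_deriv [CompleteSpace E] {w w' : ℝ → E} (hd : ∀ t, HasDerivAt w (w' t) t)
    (hw : Integrable w) (hw' : Integrable w') (η : ℝ) : cosT w' η = η • sinT w η := by
  have h := integral_eq_zero_of_hasDerivAt_of_integrable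
    (f := fun t => cos (η * t) • w t) (f' := fun t => cos (η * t) • w' t - η • sin (η * t) • w t)
    (fun t => ?_) ((integrable_cos_smul hw' η).sub ((integrable_sin_smul hw η).fun_smul η))
    (integrable_cos_smul hw η)
  · rw [integral_sub (integrable_cos_smul hw' η) ((integrable_sin_smul hw η).fun_smul η),
      integral_smul] at h
    exact sub_eq_zero.mp h
  · have hc : HasDerivAt (fun t => cos (η * t)) (-sin (η * t) * η) t := by
      simpa using ((hasDerivAt_id t).const_mul η).cos
    refine (hc.smul (hd t)).congr_deriv ?_
    module

theorem sinT_deriv [CompleteSpace E] {w w' : ℝ → E} (hd : ∀ t, HasDerivAt w (w' t) t)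
    (hw : Integrable w) (hw' : Integrable w') (η : ℝ) : sinT w' η = -(η • cosT w η) := by
  have h := integral_eq_zero_of_hasDerivAt_of_integrable
    (f := fun t => sin (η * t) • w t) (f' := fun t => sin (η * t) • w' t + η • cos (η * t) • w t)
    (fun t => ?_) ((integrable_sin_smul hw' η).add ((integrable_cos_smul hw η).fun_smul η))
    (integrable_sin_smul hw η)
  · rw [integral_add (integrable_sin_smul hw' η) ((integrable_cos_smul hw η).fun_smul η),
      integral_smul] at h
    exact eq_neg_of_add_eq_zero_left h
  · have hc : HasDerivAt (fun t => sin (η * t)) (cos (η * t) * η) t := by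
      simpa using ((hasDerivAt_id t).const_mul η).sin
    refine (hc.smul (hd t)).congr_deriv ?_
    module

theorem cosT_shift {w : ℝ → E} (hw : Integrable w) (τ η : ℝ) :
    cosT (fun t => w (t - τ)) η = cos (η * τ) • cosT w η - sin (η * τ) • sinT w η := by
  unfold cosT sinT
  rw [← integral_smul, ← integral_smul, ← integral_sub ((integrable_cos_smul hw η).fun_smul _)
    ((integrable_sin_smul hw η).fun_smul _),
    ← integral_sub_right_eq_self (fun t => cos (η * τ) • cos (η * t) • w t -
      sin (η * τ) • sin (η * t) • w t) τ]
  congr 1 with t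
  rw [show η * t = η * τ + η * (t - τ) by ring, cos_add]
  module

theorem sinT_shift {w : ℝ → E} (hw : Integrable w) (τ η : ℝ) :
    sinT (fun t => w (t - τ)) η = sin (η * τ) • cosT w η + cos (η * τ) • sinT w η := by
  unfold cosT sinT
  rw [← integral_smul, ← integral_smul, ← integral_add ((integrable_cos_smul hw η).fun_smul _)
    ((integrable_sin_smul hw η).fun_smul _),
    ← integral_sub_right_eq_self (fun t => sin (η * τ) • cos (η * t) • w t +
      cos (η * τ) • sin (η * t) • w t) τ]
  congr 1 with t
  rw [show η * t = η * τ + η * (t - τ) by ring, sin_add]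
  module

theorem cosT_clm [CompleteSpace E] {w : ℝ → E} (hw : Integrable w) (A : E →L[ℝ] E) (η : ℝ) :
    cosT (fun t => A (w t)) η = A (cosT w η) := by
  unfold cosT
  rw [← A.integral_comp_comm (integrable_cos_smul hw η)]
  simp

theorem sinT_clm [CompleteSpace E] {w : ℝ → E} (hw : Integrable w) (A : E →L[ℝ] E) (η : ℝ) :
    sinT (fun t => A (w t)) η = A (sinT w η) := by
  unfold sinT
  rw [← A.integral_comp_comm (integrable_sin_smul hw η)]
  simp

/-! ### The symbol of the delay equation -/

/-- The quasi-polynomial `z + ∑ᵢ Qᵢ exp(-z τᵢ)` at `z = σ + i η` is bounded away from zero on the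
closed right half plane. For `|η| ≤ R` all angles `η τᵢ` are smaller than `π / 2`, and the real
part is bounded below; for `|η| > R` the term `η` dominates the imaginary part. -/
theorem exists_symbol_bound {r : ℕ} {μ l h : ℝ} (hμ : 0 < μ) (hl : 0 ≤ l) (hh : 0 ≤ h)
    (hlh : l * h < π / 2) (τ : Fin r → ℝ) (hτ : ∀ i, 0 ≤ τ i ∧ τ i ≤ h) :
    ∃ c : ℝ, 0 < c ∧ ∀ (σ η X : ℝ) (Q : Fin r → ℝ), 0 ≤ σ → 0 ≤ X → (∀ i, 0 ≤ Q i) →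
      μ * X ≤ ∑ i, Q i → ∑ i, Q i ≤ l * X →
      c * X ≤ max |σ * X + ∑ i, exp (-σ * τ i) * cos (η * τ i) * Q i|
        |η * X - ∑ i, exp (-σ * τ i) * sin (η * τ i) * Q i| := by
  obtain ⟨R, hlR, hR⟩ : ∃ R, l < R ∧ R * h < π / 2 := by
    have h1 : Tendsto (fun R : ℝ => R * h) (𝓝[>] l) (𝓝 (l * h)) :=
      ((continuous_id.mul continuous_const).tendsto l).mono_left nhdsWithin_le_nhds
    obtain ⟨R, h2, h3⟩ := ((h1.eventually_lt_const hlh).and self_mem_nhdsWithin).exists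
    exact ⟨R, h3, h2⟩
  have hR0 : 0 ≤ R := hl.trans hlR.le
  have hκ : 0 < cos (R * h) :=
    cos_pos_of_mem_Ioo ⟨by have := mul_nonneg hR0 hh; linarith [pi_pos], hR⟩
  refine ⟨min 1 (min (cos (R * h) * exp (-h) * μ) (R - l)), ?_, ?_⟩
  · have := exp_pos (-h)
    have : 0 < R - l := by linarith
    positivity
  intro σ η X Q hσ hX hQ hlow hup
  have he1 : ∀ i, exp (-σ * τ i) ≤ 1 := fun i => by
    rw [exp_le_one_iff]
    have := mul_nonneg hσ (hτ i).1
    linarith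
  rcases le_or_gt |η| R with hη | hη
  · refine le_trans ?_ (le_max_left _ _)
    refine le_trans ?_ (le_abs_self _)
    have hcos : ∀ i, cos (R * h) ≤ cos (η * τ i) := fun i => by
      rw [← cos_abs (η * τ i)]
      refine cos_le_cos_of_nonneg_of_le_pi (abs_nonneg _) (by linarith [pi_pos]) ?_
      rw [abs_mul, abs_of_nonneg (hτ i).1]
      exact mul_le_mul hη (hτ i).2 (hτ i).1 hR0
    rcases le_or_gt 1 σ with h1 | h1
    · have hs : 0 ≤ ∑ i, exp (-σ * τ i) * cos (η * τ i) * Q i :=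
        Finset.sum_nonneg fun i _ => mul_nonneg (mul_nonneg (exp_pos _).le
          (hκ.le.trans (hcos i))) (hQ i)
      calc _ ≤ 1 * X := mul_le_mul_of_nonneg_right (min_le_left _ _) hX
        _ ≤ σ * X := mul_le_mul_of_nonneg_right h1 hX
        _ ≤ _ := by linarith
    · have hs : cos (R * h) * exp (-h) * (∑ i, Q i)
          ≤ ∑ i, exp (-σ * τ i) * cos (η * τ i) * Q i := by
        rw [Finset.mul_sum]
        refine Finset.sum_le_sum fun i _ => mul_le_mul_of_nonneg_right ?_ (hQ i)
        rw [mul_comm]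
        refine mul_le_mul (exp_le_exp.mpr ?_) (hcos i) hκ.le (exp_pos _).le
        nlinarith [(hτ i).1, (hτ i).2]
      calc _ ≤ (cos (R * h) * exp (-h) * μ) * X :=
            mul_le_mul_of_nonneg_right ((min_le_right _ _).trans (min_le_left _ _)) hX
        _ = cos (R * h) * exp (-h) * (μ * X) := by ring
        _ ≤ cos (R * h) * exp (-h) * (∑ i, Q i) :=
            mul_le_mul_of_nonneg_left hlow (mul_pos hκ (exp_pos _)).le
        _ ≤ _ := by nlinarith [mul_nonneg hσ hX]
  · refine le_trans ?_ (le_max_right _ _)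
    have hs : |∑ i, exp (-σ * τ i) * sin (η * τ i) * Q i| ≤ l * X := by
      refine (Finset.abs_sum_le_sum_abs _ _).trans (le_trans ?_ hup)
      refine Finset.sum_le_sum fun i _ => ?_
      rw [abs_mul, abs_mul, abs_of_nonneg (hQ i), abs_of_nonneg (exp_pos _).le]
      exact mul_le_of_le_one_left (hQ i)
        (mul_le_one₀ (he1 i) (abs_nonneg _) (abs_sin_le_one _))
    calc _ ≤ (R - l) * X :=
          mul_le_mul_of_nonneg_right ((min_le_right _ _).trans (min_le_right _ _)) hX
      _ ≤ |η| * X - l * X := by nlinarith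
      _ ≤ |η * X| - |∑ i, exp (-σ * τ i) * sin (η * τ i) * Q i| := by
          rw [abs_mul, abs_of_nonneg hX]; linarith
      _ ≤ _ := abs_sub_abs_le_abs_sub _ _

/-- The standing assumptions on the coefficients: symmetric and negative semidefinite operators,
whose sum `S` satisfies `μ ≤ -S ≤ l` in the sense of quadratic forms. -/
structure IsDissipative {r : ℕ} (A : Fin r → E →L[ℝ] E) (μ l : ℝ) : Prop where
  symm : ∀ i x y, inner ℝ (A i x) y = inner ℝ x (A i y)
  nonpos : ∀ i x, inner ℝ (A i x) x ≤ 0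
  lower : ∀ x, μ * ‖x‖ ^ 2 ≤ -∑ i, inner ℝ (A i x) x
  upper : ∀ x, -∑ i, inner ℝ (A i x) x ≤ l * ‖x‖ ^ 2

/-- Real form of the bound `c |û| ≤ |(z - ∑ᵢ exp(-z τᵢ) Aᵢ) û|` for `û = a - i b` and
`z = σ + i η`. -/
theorem IsDissipative.exists_resolvent_bound {r : ℕ} {A : Fin r → E →L[ℝ] E} {μ l h : ℝ}
    (hA : IsDissipative A μ l) (hμ : 0 < μ) (hl : 0 ≤ l) (hh : 0 ≤ h)
    (hlh : l * h < π / 2) (τ : Fin r → ℝ) (hτ : ∀ i, 0 ≤ τ i ∧ τ i ≤ h) :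
    ∃ c : ℝ, 0 < c ∧ ∀ (σ η : ℝ) (a b : E), 0 ≤ σ →
      c ^ 2 * (‖a‖ ^ 2 + ‖b‖ ^ 2) ≤
        ‖η • b + σ • a - ∑ i, exp (-σ * τ i) • A i (cos (η * τ i) • a - sin (η * τ i) • b)‖ ^ 2 +
        ‖-(η • a) + σ • b - ∑ i, exp (-σ * τ i) • A i (sin (η * τ i) • a + cos (η * τ i) • b)‖ ^ 2
        := by
  obtain ⟨c, hc, hbound⟩ := exists_symbol_bound hμ hl hh hlh τ hτ
  refine ⟨c, hc, fun σ η a b hσ => ?_⟩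
  set p := η • b + σ • a - ∑ i, exp (-σ * τ i) • A i (cos (η * τ i) • a - sin (η * τ i) • b)
    with hp
  set q := -(η • a) + σ • b -
    ∑ i, exp (-σ * τ i) • A i (sin (η * τ i) • a + cos (η * τ i) • b) with hq
  set X := ‖a‖ ^ 2 + ‖b‖ ^ 2 with hX
  have hX0 : 0 ≤ X := by positivity
  let Q : Fin r → ℝ := fun i => -(inner ℝ (A i a) a + inner ℝ (A i b) b)
  have hsym : ∀ i, inner ℝ (A i b) a = (inner ℝ (A i a) b : ℝ) := fun i => by
    rw [hA.symm, real_inner_comm]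
  -- the imaginary parts of the forms `⟨Aᵢ û, û⟩` cancel by symmetry, which leaves the scalar symbol
  have hre : inner ℝ p a + inner ℝ q b
      = σ * X + ∑ i, exp (-σ * τ i) * cos (η * τ i) * Q i := by
    have : ∑ i, exp (-σ * τ i) * cos (η * τ i) * Q i =
        -(∑ i, exp (-σ * τ i) *
          (cos (η * τ i) * inner ℝ (A i a) a - sin (η * τ i) * inner ℝ (A i b) a)) -
        ∑ i, exp (-σ * τ i) *
          (sin (η * τ i) * inner ℝ (A i a) b + cos (η * τ i) * inner ℝ (A i b) b) := by
      rw [← Finset.sum_neg_distrib, ← Finset.sum_sub_distrib]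
      refine Finset.sum_congr rfl fun i _ => ?_
      simp only [Q, hsym]
      ring
    rw [this, hX]
    simp only [hp, hq, inner_sub_left, inner_add_left, sum_inner, inner_smul_left, map_sub,
      map_add, map_smul, inner_neg_left, RCLike.conj_to_real, real_inner_self_eq_norm_sq,
      real_inner_comm a b]
    ring
  have him : inner ℝ p b - inner ℝ q a
      = η * X - ∑ i, exp (-σ * τ i) * sin (η * τ i) * Q i := by
    have : ∑ i, exp (-σ * τ i) * sin (η * τ i) * Q i =
        (∑ i, exp (-σ * τ i) *
          (cos (η * τ i) * inner ℝ (A i a) b - sin (η * τ i) * inner ℝ (A i b) b)) -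
        ∑ i, exp (-σ * τ i) *
          (sin (η * τ i) * inner ℝ (A i a) a + cos (η * τ i) * inner ℝ (A i b) a) := by
      rw [← Finset.sum_sub_distrib]
      refine Finset.sum_congr rfl fun i _ => ?_
      simp only [Q, hsym]
      ring
    rw [this, hX]
    simp only [hp, hq, inner_sub_left, inner_add_left, sum_inner, inner_smul_left, map_sub,
      map_add, map_smul, inner_neg_left, RCLike.conj_to_real, real_inner_self_eq_norm_sq,
      real_inner_comm a b]
    ring
  have hmain := hbound σ η X Q hσ hX0
    (fun i => by have := hA.nonpos i a; have := hA.nonpos i b; simp only [Q]; linarith)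
    (by
      have h1 := hA.lower a
      have h2 := hA.lower b
      simp only [Q, Finset.sum_neg_distrib, Finset.sum_add_distrib, hX]
      linarith)
    (by
      have h1 := hA.upper a
      have h2 := hA.upper b
      simp only [Q, Finset.sum_neg_distrib, Finset.sum_add_distrib, hX]
      linarith)
  rw [← hre, ← him] at hmain
  have hcs : c * X ≤ max (‖p‖ * ‖a‖ + ‖q‖ * ‖b‖) (‖p‖ * ‖b‖ + ‖q‖ * ‖a‖) :=
    hmain.trans (max_le_max
      ((abs_add_le _ _).trans (add_le_add (abs_real_inner_le_norm _ _)
        (abs_real_inner_le_norm _ _)))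
      ((abs_sub _ _).trans (add_le_add (abs_real_inner_le_norm _ _)
        (abs_real_inner_le_norm _ _))))
  have hsq : (c * X) ^ 2 ≤ (‖p‖ ^ 2 + ‖q‖ ^ 2) * X := by
    rcases le_max_iff.mp hcs with h1 | h1
    · refine (pow_le_pow_left₀ (by positivity) h1 2).trans ?_
      rw [hX]
      nlinarith [sq_nonneg (‖p‖ * ‖b‖ - ‖q‖ * ‖a‖)]
    · refine (pow_le_pow_left₀ (by positivity) h1 2).trans ?_
      rw [hX]
      nlinarith [sq_nonneg (‖p‖ * ‖a‖ - ‖q‖ * ‖b‖)]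
  rcases hX0.eq_or_lt with h0 | h0
  · rw [← h0, mul_zero]; positivity
  · refine le_of_mul_le_mul_right ?_ h0
    linarith [hsq]

/-- The delay operator `w ↦ w' + σ w - ∑ᵢ exp(-σ τᵢ) Aᵢ w(· - τᵢ)` is bounded below in `L²(ℝ)`,
uniformly in `σ ≥ 0`. -/
theorem IsDissipative.exists_L2_bound [FiniteDimensional ℝ E] {r : ℕ} {A : Fin r → E →L[ℝ] E}
    {μ l h : ℝ}
    (hA : IsDissipative A μ l) (hμ : 0 < μ) (hl : 0 ≤ l) (hh : 0 ≤ h)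
    (hlh : l * h < π / 2) (τ : Fin r → ℝ) (hτ : ∀ i, 0 ≤ τ i ∧ τ i ≤ h) :
    ∃ c : ℝ, 0 < c ∧ ∀ (σ : ℝ) (w w' : ℝ → E), 0 ≤ σ → (∀ t, HasDerivAt w (w' t) t) →
      Integrable w → MemLp w 2 → Integrable w' → MemLp w' 2 →
      c ^ 2 * ∫ t, ‖w t‖ ^ 2 ≤
        ∫ t, ‖w' t + σ • w t - ∑ i, exp (-σ * τ i) • A i (w (t - τ i))‖ ^ 2 := by
  obtain ⟨c, hc, hbound⟩ := hA.exists_resolvent_bound hμ hl hh hlh τ hτ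
  refine ⟨c, hc, fun σ w w' hσ hd h1 h2 h1' h2' => ?_⟩
  have hsh1 : ∀ i, Integrable fun t => w (t - τ i) := fun i => h1.comp_sub_right (τ i)
  have hsh2 : ∀ i, MemLp (fun t => w (t - τ i)) 2 := fun i =>
    h2.comp_measurePreserving (measurePreserving_sub_right volume (τ i))
  have hA1 : ∀ i, Integrable fun t => A i (w (t - τ i)) := fun i =>
    (A i).integrable_comp (hsh1 i)
  have hA2 : ∀ i, MemLp (fun t => A i (w (t - τ i))) 2 := fun i =>
    (A i).comp_memLp' (hsh2 i)
  have hs1 : Integrable fun t => ∑ i, exp (-σ * τ i) • A i (w (t - τ i)) :=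
    integrable_finsetSum _ fun i _ => (hA1 i).smul _
  have hs2 : MemLp (fun t => ∑ i, exp (-σ * τ i) • A i (w (t - τ i))) 2 :=
    memLp_finsetSum _ fun i _ => (hA2 i).const_smul _
  set g : ℝ → E := fun t => w' t + σ • w t - ∑ i, exp (-σ * τ i) • A i (w (t - τ i)) with hg
  have hg1 : Integrable g := (h1'.add (h1.smul σ)).sub hs1
  have hg2 : MemLp g 2 := (h2'.add (h2.const_smul σ)).sub hs2
  have hcos : ∀ η, cosT g η = η • sinT w η + σ • cosT w η -
      ∑ i, exp (-σ * τ i) • A i (cos (η * τ i) • cosT w η - sin (η * τ i) • sinT w η) := by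
    intro η
    have e : cosT g η = cosT w' η + σ • cosT w η -
        ∑ i, exp (-σ * τ i) • cosT (fun t => A i (w (t - τ i))) η := by
      have e1 := integrable_cos_smul h1' η
      have e2 := (integrable_cos_smul h1 η).fun_smul σ
      have e3 := fun i => (integrable_cos_smul (hA1 i) η).fun_smul (exp (-σ * τ i))
      unfold cosT
      simp only [← integral_smul]
      rw [← integral_finsetSum _ fun i _ => e3 i, ← integral_add e1 e2,
        ← integral_sub (e1.fun_add e2) (integrable_finsetSum _ fun i _ => e3 i)]
      congr 1 with t
      simp only [hg, smul_sub, smul_add, Finset.smul_sum, smul_comm (cos (η * t))]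
    rw [e, cosT_deriv hd h1 h1']
    congr 1
    refine Finset.sum_congr rfl fun i _ => ?_
    rw [cosT_clm (hsh1 i), cosT_shift h1]
  have hsin : ∀ η, sinT g η = -(η • cosT w η) + σ • sinT w η -
      ∑ i, exp (-σ * τ i) • A i (sin (η * τ i) • cosT w η + cos (η * τ i) • sinT w η) := by
    intro η
    have e : sinT g η = sinT w' η + σ • sinT w η -
        ∑ i, exp (-σ * τ i) • sinT (fun t => A i (w (t - τ i))) η := by
      have e1 := integrable_sin_smul h1' η
      have e2 := (integrable_sin_smul h1 η).fun_smul σ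
      have e3 := fun i => (integrable_sin_smul (hA1 i) η).fun_smul (exp (-σ * τ i))
      unfold sinT
      simp only [← integral_smul]
      rw [← integral_finsetSum _ fun i _ => e3 i, ← integral_add e1 e2,
        ← integral_sub (e1.fun_add e2) (integrable_finsetSum _ fun i _ => e3 i)]
      congr 1 with t
      simp only [hg, smul_sub, smul_add, Finset.smul_sum, smul_comm (sin (η * t))]
    rw [e, sinT_deriv hd h1 h1']
    congr 1
    refine Finset.sum_congr rfl fun i _ => ?_
    rw [sinT_clm (hsh1 i), sinT_shift h1]
  obtain ⟨iw, ew⟩ := plancherel_cos_sin h1 h2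
  obtain ⟨ig, eg⟩ := plancherel_cos_sin hg1 hg2
  change _ ≤ ∫ t, ‖g t‖ ^ 2
  rw [← ew, ← eg, ← integral_const_mul]
  refine integral_mono (iw.const_mul _) ig fun ξ => ?_
  simp only [hcos, hsin]
  exact hbound σ _ _ _ hσ

end

section

variable {E : Type*} [NormedAddCommGroup E]

/-! ### Elementary `L²` estimates -/

theorem integrable_exp_neg_abs {ε : ℝ} (hε : 0 < ε) : Integrable fun t : ℝ => exp (-ε * |t|) := by
  have h1 : IntegrableOn (fun t : ℝ => exp (-ε * |t|)) (Set.Ioi 0) := by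
    refine (integrableOn_exp_mul_Ioi (neg_neg_of_pos hε) 0).congr_fun (fun t ht => ?_)
      measurableSet_Ioi
    simp only
    rw [abs_of_pos ht]
  have h2 : IntegrableOn (fun t : ℝ => exp (-ε * |t|)) (Set.Iic 0) := by
    refine (integrableOn_exp_mul_Iic hε 0).congr_fun (fun t ht => ?_) measurableSet_Iic
    simp only
    rw [abs_of_nonpos ht, neg_mul_neg]
  rw [← integrableOn_univ, ← Set.Iic_union_Ioi (a := (0 : ℝ))]
  exact h2.union h1

theorem integrable_and_memLp_of_norm_le_exp {F : ℝ → E} (hF : Continuous F)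
    {K ε : ℝ} (hε : 0 < ε) (hb : ∀ t, ‖F t‖ ≤ K * exp (-ε * |t|)) :
    Integrable F ∧ MemLp F 2 := by
  have hm : AEStronglyMeasurable F volume := hF.aestronglyMeasurable
  refine ⟨((integrable_exp_neg_abs hε).const_mul K).mono' hm (Eventually.of_forall hb), ?_⟩
  rw [memLp_two_iff_integrable_sq_norm hm]
  refine ((integrable_exp_neg_abs (mul_pos two_pos hε)).const_mul (K ^ 2)).mono'
    (by fun_prop) (Eventually.of_forall fun t => ?_)
  rw [norm_of_nonneg (by positivity)]
  refine (pow_le_pow_left₀ (norm_nonneg _) (hb t) 2).trans (le_of_eq ?_)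
  rw [mul_pow, ← exp_nat_mul]
  congr 2
  push_cast
  ring

/-- The `L²` consequence of a pointwise bound by `w`, `q` and finitely many translates of `w`,
whose `L²` norms all equal that of `w`. -/
theorem integral_sq_le_of_delay_bound {r : ℕ} {w q G : ℝ → E} {α β : ℝ}
    (τ : Fin r → ℝ) (hw : MemLp w 2) (hq : MemLp q 2) (hG : MemLp G 2)
    (hb : ∀ t, ‖G t‖ ≤ α * ‖w t‖ + ‖q t‖ + β * ∑ i, ‖w (t - τ i)‖) :
    ∫ t, ‖G t‖ ^ 2 ≤
      3 * (α ^ 2 + β ^ 2 * r ^ 2) * (∫ t, ‖w t‖ ^ 2) + 3 * ∫ t, ‖q t‖ ^ 2 := by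
  have iw : Integrable fun t => ‖w t‖ ^ 2 := hw.integrable_norm_pow (by norm_num)
  have iq : Integrable fun t => ‖q t‖ ^ 2 := hq.integrable_norm_pow (by norm_num)
  have iG : Integrable fun t => ‖G t‖ ^ 2 := hG.integrable_norm_pow (by norm_num)
  have is : ∀ i, Integrable fun t => ‖w (t - τ i)‖ ^ 2 := fun i => iw.comp_sub_right (τ i)
  have iS : Integrable fun t => ∑ i, ‖w (t - τ i)‖ ^ 2 := integrable_finsetSum _ fun i _ => is i
  have hpt : ∀ t, ‖G t‖ ^ 2 ≤ (3 * α ^ 2) * ‖w t‖ ^ 2 + 3 * ‖q t‖ ^ 2 +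
      (3 * β ^ 2 * r) * ∑ i, ‖w (t - τ i)‖ ^ 2 := by
    intro t
    have hS : (∑ i, ‖w (t - τ i)‖) ^ 2 ≤ r * ∑ i, ‖w (t - τ i)‖ ^ 2 := by
      simpa using sq_sum_le_card_mul_sum_sq (s := Finset.univ) (f := fun i => ‖w (t - τ i)‖)
    set S := ∑ i, ‖w (t - τ i)‖
    have h1 := pow_le_pow_left₀ (norm_nonneg _) (hb t) 2
    have h2 := mul_le_mul_of_nonneg_left hS (sq_nonneg β)
    nlinarith [sq_nonneg (α * ‖w t‖ - ‖q t‖), sq_nonneg (α * ‖w t‖ - β * S),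
      sq_nonneg (‖q t‖ - β * S)]
  calc ∫ t, ‖G t‖ ^ 2 ≤ ∫ t, ((3 * α ^ 2) * ‖w t‖ ^ 2 + 3 * ‖q t‖ ^ 2 +
      (3 * β ^ 2 * r) * ∑ i, ‖w (t - τ i)‖ ^ 2) :=
        integral_mono iG (((iw.const_mul _).add (iq.const_mul _)).add (iS.const_mul _)) hpt
    _ = _ := by
      rw [integral_add ((iw.const_mul _).fun_add (iq.const_mul _)) (iS.const_mul _),
        integral_add (iw.const_mul _) (iq.const_mul _), integral_const_mul, integral_const_mul,
        integral_const_mul, integral_finsetSum _ fun i _ => is i]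
      simp only [integral_sub_right_eq_self (fun t => ‖w t‖ ^ 2), Finset.sum_const,
        Finset.card_univ, Fintype.card_fin, nsmul_eq_mul]
      ring

variable [InnerProductSpace ℝ E]

theorem sq_norm_le_integral {w w' : ℝ → E} (hd : ∀ t, HasDerivAt w (w' t) t)
    (hc : Continuous w') (hw : MemLp w 2) (hw' : MemLp w' 2) (h0 : w 0 = 0) {t : ℝ}
    (ht : 0 ≤ t) : ‖w t‖ ^ 2 ≤ (∫ s, ‖w s‖ ^ 2) + ∫ s, ‖w' s‖ ^ 2 := by
  have iw : Integrable fun t => ‖w t‖ ^ 2 := hw.integrable_norm_pow (by norm_num)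
  have iw' : Integrable fun t => ‖w' t‖ ^ 2 := hw'.integrable_norm_pow (by norm_num)
  have hwc : Continuous w := continuous_iff_continuousAt.mpr fun t => (hd t).continuousAt
  have hd2 : ∀ s, HasDerivAt (fun s => ‖w s‖ ^ 2) (2 * inner ℝ (w s) (w' s)) s := fun s =>
    (hd s).norm_sq
  have hcont : Continuous fun s => 2 * inner ℝ (w s) (w' s) :=
    continuous_const.mul (hwc.inner hc)
  have h1 := intervalIntegral.integral_eq_sub_of_hasDerivAt (a := 0) (b := t)
    (fun s _ => hd2 s) (hcont.intervalIntegrable _ _)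
  simp only [h0, norm_zero, ne_eq, OfNat.ofNat_ne_zero, not_false_eq_true, zero_pow,
    sub_zero] at h1
  rw [← h1, intervalIntegral.integral_of_le ht, ← integral_add iw iw']
  refine (integral_mono (hcont.integrableOn_Ioc) (iw.add iw').integrableOn fun s => ?_).trans
    (setIntegral_le_integral (iw.add iw') (Eventually.of_forall fun s => ?_))
  · have h2 := real_inner_le_norm (w s) (w' s)
    simp only [Pi.add_apply]
    nlinarith [sq_nonneg (‖w s‖ - ‖w' s‖)]
  · simp only [Pi.zero_apply, Pi.add_apply]
    positivity

/-! ### The exponential weights -/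

/-- The reciprocal weight `exp (-ε t) + δ exp (ε t)`. Its reciprocal tends to `exp (ε t)` as
`δ → 0` and is integrable for `δ > 0`, while its logarithm varies at rate at most `ε`. -/
def recipWeight (ε δ t : ℝ) : ℝ := exp (-ε * t) + δ * exp (ε * t)

theorem recipWeight_pos {ε δ : ℝ} (hδ : 0 < δ) (t : ℝ) : 0 < recipWeight ε δ t := by
  unfold recipWeight; positivity

/-- The derivative of `recipWeight`. -/
def recipWeightDeriv (ε δ t : ℝ) : ℝ := -ε * exp (-ε * t) + δ * (ε * exp (ε * t))

theorem hasDerivAt_recipWeight (ε δ t : ℝ) :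
    HasDerivAt (recipWeight ε δ) (recipWeightDeriv ε δ t) t := by
  have h1 : HasDerivAt (fun t => exp (-ε * t)) (exp (-ε * t) * -ε) t := by
    simpa using ((hasDerivAt_id t).const_mul (-ε)).exp
  have h2 : HasDerivAt (fun t => exp (ε * t)) (exp (ε * t) * ε) t := by
    simpa using ((hasDerivAt_id t).const_mul ε).exp
  refine (h1.add (h2.const_mul δ)).congr_deriv ?_
  unfold recipWeightDeriv
  ring

theorem abs_recipWeightDeriv_le {ε δ : ℝ} (hε : 0 < ε) (hδ : 0 < δ) (t : ℝ) :
    |recipWeightDeriv ε δ t| ≤ ε * recipWeight ε δ t := by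
  have h1 := mul_pos hε (exp_pos (-ε * t))
  have h2 := mul_pos hδ (mul_pos hε (exp_pos (ε * t)))
  unfold recipWeightDeriv recipWeight
  rw [abs_le]
  constructor <;> nlinarith

theorem continuous_recipWeight (ε δ : ℝ) : Continuous (recipWeight ε δ) := by
  unfold recipWeight; fun_prop

theorem continuous_recipWeightDeriv (ε δ : ℝ) : Continuous (recipWeightDeriv ε δ) := by
  unfold recipWeightDeriv; fun_prop

theorem recipWeight_sub_le {ε δ s h : ℝ} (hε : 0 < ε) (hδ : 0 < δ) (hs : 0 ≤ s) (hsh : s ≤ h)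
    (t : ℝ) : recipWeight ε δ (t - s) ≤ exp (ε * h) * recipWeight ε δ t := by
  unfold recipWeight
  rw [mul_add, mul_left_comm, ← exp_add, ← exp_add]
  gcongr <;> nlinarith

theorem abs_recipWeight_sub_sub_le {ε δ s h : ℝ} (hε : 0 < ε) (hδ : 0 < δ) (hs : 0 ≤ s)
    (hsh : s ≤ h) (t : ℝ) :
    |recipWeight ε δ (t - s) - recipWeight ε δ t| ≤ (exp (ε * h) - 1) * recipWeight ε δ t := by
  have h1 := recipWeight_sub_le hε hδ hs hsh t
  have h2 : exp (-(ε * h)) * recipWeight ε δ t ≤ recipWeight ε δ (t - s) := by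
    unfold recipWeight
    rw [mul_add, mul_left_comm, ← exp_add, ← exp_add]
    gcongr <;> nlinarith
  have h3 : 2 ≤ exp (ε * h) + exp (-(ε * h)) := by
    have := one_le_cosh (ε * h)
    rw [cosh_eq] at this
    linarith
  have h4 := recipWeight_pos (ε := ε) hδ t
  rw [abs_le]
  constructor <;> nlinarith

theorem inv_recipWeight_le {ε δ : ℝ} (hδ : 0 < δ) (t : ℝ) :
    (recipWeight ε δ t)⁻¹ ≤ exp (ε * t) := by
  rw [← neg_neg (ε * t), exp_neg (-(ε * t)), ← neg_mul]
  refine inv_anti₀ (exp_pos _) ?_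
  unfold recipWeight
  have := mul_pos hδ (exp_pos (ε * t))
  linarith

theorem inv_recipWeight_le_abs {ε δ : ℝ} (hδ : 0 < δ) (t : ℝ) :
    (recipWeight ε δ t)⁻¹ ≤ max 1 δ⁻¹ * exp (-ε * |t|) := by
  rcases le_total t 0 with ht | ht
  · refine (inv_recipWeight_le hδ t).trans ?_
    rw [abs_of_nonpos ht, neg_mul_neg]
    exact le_mul_of_one_le_left (exp_pos _).le (le_max_left _ _)
  · rw [abs_of_nonneg ht]
    calc (recipWeight ε δ t)⁻¹ ≤ (δ * exp (ε * t))⁻¹ := by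
          refine inv_anti₀ (by positivity) ?_
          unfold recipWeight
          have := exp_pos (-ε * t)
          linarith
      _ = δ⁻¹ * exp (-ε * t) := by rw [mul_inv, ← exp_neg, neg_mul]
      _ ≤ _ := mul_le_mul_of_nonneg_right (le_max_right _ _) (exp_pos _).le

end

section

variable {E : Type*} [NormedAddCommGroup E] [InnerProductSpace ℝ E]

/-! ### Decay of the forced equation with zero history -/

/-- `u` solves `u' = ∑ᵢ Aᵢ u(· - τᵢ) + f` on the whole line, vanishes on `(-∞, 0]`, and the forcing
`f` is continuous, bounded by `B` and vanishes outside `[0, L]`. -/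
structure IsForcedSolution {r : ℕ} (A : Fin r → E →L[ℝ] E) (τ : Fin r → ℝ) (L B : ℝ)
    (u f : ℝ → E) : Prop where
  hasDerivAt : ∀ t, HasDerivAt u (∑ i, A i (u (t - τ i)) + f t) t
  eq_zero : ∀ t ≤ 0, u t = 0
  continuous_forcing : Continuous f
  norm_forcing_le : ∀ t, ‖f t‖ ≤ B
  forcing_eq_zero : ∀ t, t ∉ Set.Icc 0 L → f t = 0

/-- A sum of operators applied to vectors is bounded by the sum of the operator norms times the
sum of the norms. -/
theorem norm_sum_apply_le {r : ℕ} (A : Fin r → E →L[ℝ] E) (x : Fin r → E) :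
    ‖∑ i, A i (x i)‖ ≤ (∑ i, ‖A i‖) * ∑ i, ‖x i‖ := by
  rw [Finset.mul_sum]
  refine norm_sum_le_of_le _ fun i _ => ((A i).le_opNorm _).trans ?_
  exact mul_le_mul_of_nonneg_right
    (Finset.single_le_sum (f := fun i => ‖A i‖) (fun j _ => norm_nonneg _) (Finset.mem_univ i))
    (norm_nonneg _)

theorem IsForcedSolution.continuous {r : ℕ} {A : Fin r → E →L[ℝ] E} {τ : Fin r → ℝ} {L B : ℝ}
    {u f : ℝ → E} (hu : IsForcedSolution A τ L B u f) : Continuous u :=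
  continuous_iff_continuousAt.mpr fun t => (hu.hasDerivAt t).continuousAt

/-- Weighted sup estimate for the forced equation: the weight `exp (-σ t) / recipWeight ε δ t`
nearly conjugates the equation to the one with exponent `σ`, and the `L²` bound for the latter
absorbs the error. The constant does not depend on `δ`. -/
theorem IsForcedSolution.weighted_bound [CompleteSpace E] {r : ℕ} {A : Fin r → E →L[ℝ] E}
    {τ : Fin r → ℝ} {L B h c ε σ δ C : ℝ} {u f : ℝ → E} (hu : IsForcedSolution A τ L B u f)
    (hτ : ∀ i, 0 ≤ τ i ∧ τ i ≤ h) (hL : 0 ≤ L) (hc : 0 < c) (hε : 0 < ε) (hδ : 0 < δ)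
    (hσ : 0 ≤ σ)
    (hL2 : ∀ w w' : ℝ → E, (∀ t, HasDerivAt w (w' t) t) →
      Integrable w → MemLp w 2 → Integrable w' → MemLp w' 2 →
      c ^ 2 * ∫ t, ‖w t‖ ^ 2 ≤
        ∫ t, ‖w' t + σ • w t - ∑ i, exp (-σ * τ i) • A i (w (t - τ i))‖ ^ 2)
    (hsmall : 3 * (ε ^ 2 + ((exp (ε * h) - 1) * ∑ i, ‖A i‖) ^ 2 * r ^ 2) ≤ c ^ 2 / 2)
    (hC : ∀ t, ‖u t‖ ≤ C * exp (σ * t)) (t : ℝ) (ht : 0 ≤ t) :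
    (exp (-σ * t) * (recipWeight ε δ t)⁻¹ * ‖u t‖) ^ 2 ≤
      ((1 + 3 * ((σ + ε) ^ 2 + (exp (ε * h) * ∑ i, ‖A i‖) ^ 2 * r ^ 2)) * (6 / c ^ 2) + 3) *
        (L * exp (ε * L) ^ 2) * B ^ 2 := by
  set a := ∑ i, ‖A i‖
  have ha0 : 0 ≤ a := Finset.sum_nonneg fun i _ => norm_nonneg _
  have hB0 : 0 ≤ B := (norm_nonneg _).trans (hu.norm_forcing_le 0)
  have hC0 : 0 ≤ C := by simpa [hu.eq_zero 0 le_rfl] using hC 0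
  let D := recipWeight ε δ
  let D' := recipWeightDeriv ε δ
  have hD : ∀ t, 0 < D t := fun t => recipWeight_pos hδ t
  let p : ℝ → ℝ := fun t => exp (-σ * t) * (D t)⁻¹
  have hp0 : ∀ t, 0 < p t := fun t => mul_pos (exp_pos _) (inv_pos.mpr (hD t))
  let p' : ℝ → ℝ := fun t => -(σ + D' t / D t) * p t
  have hDc : Continuous D := continuous_recipWeight ε δ
  have hD'c : Continuous D' := continuous_recipWeightDeriv ε δ
  have hpc : Continuous p := by
    refine (by fun_prop : Continuous fun t => exp (-σ * t)).mul (hDc.inv₀ fun t => (hD t).ne')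
  have hp'c : Continuous p' :=
    ((continuous_const.add (hD'c.div hDc fun t => (hD t).ne')).neg).mul hpc
  have hpd : ∀ t, HasDerivAt p (p' t) t := by
    intro t
    have h1 : HasDerivAt (fun t => exp (-σ * t)) (exp (-σ * t) * -σ) t := by
      simpa using ((hasDerivAt_id t).const_mul (-σ)).exp
    refine (h1.mul ((hasDerivAt_recipWeight ε δ t).inv (hD t).ne')).congr_deriv ?_
    have := (hD t).ne'
    simp only [p', p, D', D, Pi.inv_apply] at this ⊢
    field_simp
    ring
  have hquot : ∀ t, |D' t / D t| ≤ ε := fun t => by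
    rw [abs_div, abs_of_pos (hD t), div_le_iff₀ (hD t)]
    exact abs_recipWeightDeriv_le hε hδ t
  have hpshift : ∀ t s, p t = exp (-σ * s) * (D (t - s) / D t) * p (t - s) := by
    intro t s
    have h1 := (hD t).ne'
    have h2 := (hD (t - s)).ne'
    simp only [p]
    rw [show -σ * t = -σ * s + -σ * (t - s) by ring, exp_add]
    field_simp
  have hratio : ∀ t i, D (t - τ i) / D t ≤ exp (ε * h) := fun t i => by
    rw [div_le_iff₀ (hD t)]
    exact recipWeight_sub_le hε hδ (hτ i).1 (hτ i).2 t
  have hratio1 : ∀ t i, |D (t - τ i) / D t - 1| ≤ exp (ε * h) - 1 := fun t i => by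
    rw [div_sub_one (hD t).ne', abs_div, abs_of_pos (hD t), div_le_iff₀ (hD t)]
    exact abs_recipWeight_sub_sub_le hε hδ (hτ i).1 (hτ i).2 t
  have hexp1 : ∀ i, exp (-σ * τ i) ≤ 1 := fun i => by
    rw [exp_le_one_iff]
    have := mul_nonneg hσ (hτ i).1
    linarith
  -- `p u(· - τᵢ)` is a multiple of the translate of `w = p u`, with a factor close to `exp (-σ τᵢ)`
  let w : ℝ → E := fun t => p t • u t
  let q : ℝ → E := fun t => p t • f t
  let w' : ℝ → E := fun t => p t • (∑ i, A i (u (t - τ i)) + f t) + p' t • u t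
  have hwd : ∀ t, HasDerivAt w (w' t) t := fun t => (hpd t).smul (hu.hasDerivAt t)
  have hpA : ∀ t i, p t • A i (u (t - τ i)) =
      (exp (-σ * τ i) * (D (t - τ i) / D t)) • A i (w (t - τ i)) := by
    intro t i
    simp only [w, map_smul, smul_smul]
    rw [← hpshift]
  have hw'eq : ∀ t, w' t = -(σ + D' t / D t) • w t + q t +
      ∑ i, A i ((exp (-σ * τ i) * (D (t - τ i) / D t)) • w (t - τ i)) := by
    intro t
    simp only [w', w, q, smul_add, Finset.smul_sum, hpA, map_smul, p', smul_smul]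
    module
  let G : ℝ → E := fun t => w' t + σ • w t - ∑ i, exp (-σ * τ i) • A i (w (t - τ i))
  have hGeq : ∀ t, G t = -(D' t / D t) • w t + q t +
      ∑ i, A i ((exp (-σ * τ i) * (D (t - τ i) / D t - 1)) • w (t - τ i)) := by
    intro t
    have e : ∑ i, A i ((exp (-σ * τ i) * (D (t - τ i) / D t - 1)) • w (t - τ i)) =
        ∑ i, A i ((exp (-σ * τ i) * (D (t - τ i) / D t)) • w (t - τ i)) -
        ∑ i, exp (-σ * τ i) • A i (w (t - τ i)) := by
      rw [← Finset.sum_sub_distrib]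
      refine Finset.sum_congr rfl fun i _ => ?_
      simp only [map_smul]
      module
    simp only [G]
    rw [hw'eq, e]
    module
  -- `w'` and `G` are bounded pointwise by `w`, the forcing `q` and the translates of `w`; in the
  -- bound for `G` the coefficients of `w` and of its translates tend to zero with `ε`
  have hsumle : ∀ (x : Fin r → ℝ) (b : ℝ) (t : ℝ), (∀ i, |x i| ≤ b) →
      ‖∑ i, A i (x i • w (t - τ i))‖ ≤ (b * a) * ∑ i, ‖w (t - τ i)‖ := by
    intro x b t hx
    refine (norm_sum_apply_le A _).trans ?_
    rw [mul_comm b a, mul_assoc, Finset.mul_sum _ _ b]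
    refine mul_le_mul_of_nonneg_left (Finset.sum_le_sum fun i _ => ?_) ha0
    rw [norm_smul, norm_eq_abs]
    exact mul_le_mul_of_nonneg_right (hx i) (norm_nonneg _)
  have hw'le : ∀ t, ‖w' t‖ ≤ (σ + ε) * ‖w t‖ + ‖q t‖ +
      (exp (ε * h) * a) * ∑ i, ‖w (t - τ i)‖ := by
    intro t
    rw [hw'eq]
    refine norm_add₃_le.trans (add_le_add (add_le_add ?_ le_rfl) (hsumle _ _ _ fun i => ?_))
    · rw [norm_smul, norm_neg, norm_eq_abs]
      refine mul_le_mul_of_nonneg_right ((abs_add_le _ _).trans ?_) (norm_nonneg _)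
      rw [abs_of_nonneg hσ]
      exact add_le_add le_rfl (hquot t)
    · rw [abs_of_pos (mul_pos (exp_pos _) (div_pos (hD _) (hD _)))]
      exact (mul_le_of_le_one_left (div_pos (hD _) (hD _)).le (hexp1 i)).trans (hratio t i)
  have hGle : ∀ t, ‖G t‖ ≤ ε * ‖w t‖ + ‖q t‖ +
      ((exp (ε * h) - 1) * a) * ∑ i, ‖w (t - τ i)‖ := by
    intro t
    rw [hGeq]
    refine norm_add₃_le.trans (add_le_add (add_le_add ?_ le_rfl) (hsumle _ _ _ fun i => ?_))
    · rw [norm_smul, norm_neg, norm_eq_abs]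
      exact mul_le_mul_of_nonneg_right (hquot t) (norm_nonneg _)
    · rw [abs_mul, abs_of_pos (exp_pos _)]
      exact (mul_le_of_le_one_left (abs_nonneg _) (hexp1 i)).trans (hratio1 t i)
  -- for fixed `δ` all functions are dominated by `exp (-ε |t|)`, as `1 / D` is, while `exp (-σ t) u` is
  -- bounded a priori and `f` vanishes for negative times
  have huc := hu.continuous
  have hwc : Continuous w := hpc.smul huc
  have hqc : Continuous q := hpc.smul hu.continuous_forcing
  have hw'c : Continuous w' := by
    refine (hpc.smul ((continuous_finsetSum _ fun i _ => ?_).add hu.continuous_forcing)).add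
      (hp'c.smul huc)
    exact (A i).continuous.comp (huc.comp (by fun_prop))
  set K := max 1 δ⁻¹
  have hK0 : 0 ≤ K := le_trans zero_le_one (le_max_left _ _)
  have hwle : ∀ t, ‖w t‖ ≤ (C * K) * exp (-ε * |t|) := by
    intro t
    rw [norm_smul, norm_of_nonneg (hp0 t).le]
    calc p t * ‖u t‖ ≤ p t * (C * exp (σ * t)) := mul_le_mul_of_nonneg_left (hC t) (hp0 t).le
      _ = C * (D t)⁻¹ * (exp (-σ * t) * exp (σ * t)) := by simp only [p]; ring
      _ = C * (D t)⁻¹ := by rw [← exp_add]; simp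
      _ ≤ C * (K * exp (-ε * |t|)) :=
        mul_le_mul_of_nonneg_left (inv_recipWeight_le_abs hδ t) hC0
      _ = _ := by ring
  have hqle : ∀ t, ‖q t‖ ≤ B * K * exp (-ε * |t|) := by
    intro t
    rw [norm_smul, norm_of_nonneg (hp0 t).le]
    by_cases h1 : t ∈ Set.Icc 0 L
    · have h2 : p t ≤ K * exp (-ε * |t|) := by
        refine (mul_le_of_le_one_left (inv_pos.mpr (hD t)).le ?_).trans
          (inv_recipWeight_le_abs hδ t)
        rw [exp_le_one_iff]
        nlinarith [h1.1]
      calc p t * ‖f t‖ ≤ (K * exp (-ε * |t|)) * B :=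
            mul_le_mul h2 (hu.norm_forcing_le t) (norm_nonneg _) (by positivity)
        _ = _ := by ring
    · rw [hu.forcing_eq_zero t h1, norm_zero, mul_zero]
      positivity
  have hw'le2 : ∀ t, ‖w' t‖ ≤ ((σ + ε) * (C * K) + B * K +
      (exp (ε * h) * a) * ∑ _i : Fin r, C * K * exp (ε * h)) * exp (-ε * |t|) := by
    intro t
    have h1 : ∀ i, ‖w (t - τ i)‖ ≤ C * K * exp (ε * h) * exp (-ε * |t|) := by
      intro i
      refine (hwle _).trans ?_
      rw [mul_assoc (C * K), ← exp_add]
      refine mul_le_mul_of_nonneg_left (exp_le_exp.mpr ?_) (by positivity)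
      have h2 : |t| ≤ |t - τ i| + h := by
        have := abs_sub_abs_le_abs_sub t (t - τ i)
        rw [sub_sub_cancel, abs_of_nonneg (hτ i).1] at this
        linarith [(hτ i).2]
      nlinarith
    have h2 : ∑ i, ‖w (t - τ i)‖ ≤ (∑ _i : Fin r, C * K * exp (ε * h)) * exp (-ε * |t|) := by
      rw [Finset.sum_mul]
      exact Finset.sum_le_sum fun i _ => h1 i
    calc ‖w' t‖ ≤ _ := hw'le t
      _ ≤ (σ + ε) * ((C * K) * exp (-ε * |t|)) + B * K * exp (-ε * |t|) + (exp (ε * h) * a) *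
          ((∑ _i : Fin r, C * K * exp (ε * h)) * exp (-ε * |t|)) := by
        gcongr
        · exact hwle t
        · exact hqle t
      _ = _ := by ring
  obtain ⟨hw1, hw2⟩ := integrable_and_memLp_of_norm_le_exp hwc hε hwle
  obtain ⟨hq1, hq2⟩ := integrable_and_memLp_of_norm_le_exp hqc hε hqle
  obtain ⟨hw'1, hw'2⟩ := integrable_and_memLp_of_norm_le_exp hw'c hε hw'le2
  have hG2 : MemLp G 2 := by
    refine (hw'2.add (hw2.const_smul σ)).sub (memLp_finsetSum _ fun i _ => ?_)
    exact ((A i).comp_memLp' (hw2.comp_measurePreserving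
      (measurePreserving_sub_right volume (τ i)))).const_smul (exp (-σ * τ i))
  -- the `L²` bound and the smallness of `ε` control `∫ ‖w‖²` by `∫ ‖q‖²`, hence also `∫ ‖w'‖²`,
  -- and the two together control `w` pointwise
  have hmain := hL2 w w' hwd hw1 hw2 hw'1 hw'2
  have hGint := integral_sq_le_of_delay_bound τ hw2 hq2 hG2 hGle
  have hw'int := integral_sq_le_of_delay_bound τ hw2 hq2 hw'2 hw'le
  have hpoint := sq_norm_le_integral hwd hw'c hw2 hw'2
    (by simp only [w, hu.eq_zero 0 le_rfl, smul_zero]) ht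
  have hqint : ∫ t, ‖q t‖ ^ 2 ≤ (L * exp (ε * L) ^ 2) * B ^ 2 := by
    have h1 : ∀ t, ‖q t‖ ^ 2 ≤ (Set.Icc 0 L).indicator (fun _ => (exp (ε * L) * B) ^ 2) t := by
      intro t
      by_cases h1 : t ∈ Set.Icc 0 L
      · rw [Set.indicator_of_mem h1]
        refine pow_le_pow_left₀ (norm_nonneg _) ?_ 2
        rw [norm_smul, norm_of_nonneg (hp0 t).le]
        refine mul_le_mul ?_ (hu.norm_forcing_le t) (norm_nonneg _) (exp_pos _).le
        refine (mul_le_of_le_one_left (inv_pos.mpr (hD t)).le ?_).trans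
          ((inv_recipWeight_le hδ t).trans ?_)
        · rw [exp_le_one_iff]
          nlinarith [h1.1]
        · exact exp_le_exp.mpr (mul_le_mul_of_nonneg_left h1.2 hε.le)
      · simp only [Set.indicator_of_notMem h1, q, hu.forcing_eq_zero t h1]
        simp
    refine (integral_mono (hq2.integrable_norm_pow (by norm_num)) ?_ h1).trans (le_of_eq ?_)
    · exact (integrable_indicator_iff measurableSet_Icc).mpr (integrableOn_const (by simp))
    · rw [integral_indicator measurableSet_Icc, setIntegral_const]
      simp [hL]
      ring
  have hlhs : (exp (-σ * t) * (recipWeight ε δ t)⁻¹ * ‖u t‖) ^ 2 = ‖w t‖ ^ 2 := by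
    simp only [w, norm_smul, norm_of_nonneg (hp0 t).le]
    rfl
  rw [hlhs]
  have hJ0 : 0 ≤ ∫ t, ‖w t‖ ^ 2 := integral_nonneg fun t => sq_nonneg _
  have hI0 : 0 ≤ ∫ t, ‖q t‖ ^ 2 := integral_nonneg fun t => sq_nonneg _
  set J := ∫ t, ‖w t‖ ^ 2
  set I := ∫ t, ‖q t‖ ^ 2
  have hJ : J ≤ 6 / c ^ 2 * I := by
    have h1 : c ^ 2 * J ≤ c ^ 2 / 2 * J + 3 * I :=
      hmain.trans (hGint.trans (add_le_add (mul_le_mul_of_nonneg_right hsmall hJ0) le_rfl))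
    rw [div_mul_eq_mul_div, le_div_iff₀ (by positivity)]
    linarith
  set Z := 3 * ((σ + ε) ^ 2 + (exp (ε * h) * a) ^ 2 * r ^ 2) with hZ
  have hZ0 : 0 ≤ Z := by positivity
  calc ‖w t‖ ^ 2 ≤ J + (Z * J + 3 * I) := hpoint.trans (add_le_add le_rfl hw'int)
    _ = (1 + Z) * J + 3 * I := by ring
    _ ≤ (1 + Z) * (6 / c ^ 2 * I) + 3 * I := by gcongr
    _ = ((1 + Z) * (6 / c ^ 2) + 3) * I := by ring
    _ ≤ ((1 + Z) * (6 / c ^ 2) + 3) * ((L * exp (ε * L) ^ 2) * B ^ 2) := by gcongr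
    _ = _ := by ring

/-- Exponential decay of the forced equation, with a rate and a constant that depend only on the
coefficients. An a priori exponential bound with exponent `σ ≥ 0` improves to the exponent `σ - ε`,
with the same `ε` for all `σ`; finitely many improvements lead to the exponent `-ε`. -/
theorem IsDissipative.exists_decay [FiniteDimensional ℝ E] {r : ℕ} {A : Fin r → E →L[ℝ] E}
    {μ l h L : ℝ} (hA : IsDissipative A μ l) (hμ : 0 < μ) (hl : 0 ≤ l) (hh : 0 ≤ h)
    (hlh : l * h < π / 2) (τ : Fin r → ℝ) (hτ : ∀ i, 0 ≤ τ i ∧ τ i ≤ h) (hL : 0 ≤ L) :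
    ∃ ε K : ℝ, 0 < ε ∧ 0 ≤ K ∧ ∀ (B : ℝ) (u f : ℝ → E), IsForcedSolution A τ L B u f →
      (∃ C σ, ∀ t, 0 ≤ t → ‖u t‖ ≤ C * exp (σ * t)) →
      ∀ t, 0 ≤ t → ‖u t‖ ≤ K * B * exp (-ε * t) := by
  obtain ⟨c, hc, hL2⟩ := hA.exists_L2_bound hμ hl hh hlh τ hτ
  obtain ⟨ε, hε, hsmall⟩ : ∃ ε : ℝ, 0 < ε ∧
      3 * (ε ^ 2 + ((exp (ε * h) - 1) * ∑ i, ‖A i‖) ^ 2 * r ^ 2) ≤ c ^ 2 / 2 := by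
    have h1 : Tendsto (fun ε : ℝ =>
        3 * (ε ^ 2 + ((exp (ε * h) - 1) * ∑ i, ‖A i‖) ^ 2 * (r : ℝ) ^ 2)) (𝓝[>] 0) (𝓝 0) := by
      have h2 : Continuous (fun ε : ℝ =>
        3 * (ε ^ 2 + ((exp (ε * h) - 1) * ∑ i, ‖A i‖) ^ 2 * (r : ℝ) ^ 2)) := by fun_prop
      have h3 := (h2.tendsto 0).mono_left (nhdsWithin_le_nhds (s := Set.Ioi 0))
      simpa using h3
    obtain ⟨ε, h2, h3⟩ := ((h1.eventually_lt_const (show 0 < c ^ 2 / 2 by positivity)).and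
      self_mem_nhdsWithin).exists
    exact ⟨ε, h3, h2.le⟩
  let K : ℝ → ℝ := fun σ => √(((1 + 3 * ((σ + ε) ^ 2 +
    (exp (ε * h) * ∑ i, ‖A i‖) ^ 2 * r ^ 2)) * (6 / c ^ 2) + 3) * (L * exp (ε * L) ^ 2))
  have step : ∀ (B : ℝ) (u f : ℝ → E), IsForcedSolution A τ L B u f → ∀ σ, 0 ≤ σ → ∀ C,
      (∀ t, 0 ≤ t → ‖u t‖ ≤ C * exp (σ * t)) →
      ∀ t, 0 ≤ t → ‖u t‖ ≤ K σ * B * exp ((σ - ε) * t) := by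
    intro B u f hu σ hσ C hC t ht
    have hB0 : 0 ≤ B := (norm_nonneg _).trans (hu.norm_forcing_le 0)
    have hC0 : 0 ≤ C := by simpa [hu.eq_zero 0 le_rfl] using hC 0 le_rfl
    have hC' : ∀ t, ‖u t‖ ≤ C * exp (σ * t) := by
      intro t
      rcases le_total 0 t with h1 | h1
      · exact hC t h1
      · rw [hu.eq_zero t h1, norm_zero]
        positivity
    have hδ : ∀ δ : ℝ, 0 < δ → ‖u t‖ ≤ K σ * B * (exp (σ * t) * recipWeight ε δ t) := by
      intro δ hδ
      have hD := recipWeight_pos (ε := ε) hδ t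
      have h1 := hu.weighted_bound hτ hL hc hε hδ hσ (fun w w' => hL2 σ w w' hσ) hsmall hC' t ht
      have h2 := abs_le_sqrt h1
      rw [sqrt_mul' _ (sq_nonneg B), sqrt_sq hB0, abs_of_nonneg (by positivity)] at h2
      calc ‖u t‖ = (exp (-σ * t) * (recipWeight ε δ t)⁻¹ * ‖u t‖) *
            (exp (σ * t) * recipWeight ε δ t) := by
            rw [neg_mul, exp_neg]
            field_simp
        _ ≤ _ := mul_le_mul_of_nonneg_right h2 (by positivity)
    have hlim : Tendsto (fun δ : ℝ => K σ * B * (exp (σ * t) * recipWeight ε δ t)) (𝓝[>] 0)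
        (𝓝 (K σ * B * exp ((σ - ε) * t))) := by
      have h2 : Continuous (fun δ : ℝ => K σ * B * (exp (σ * t) * recipWeight ε δ t)) := by
        unfold recipWeight; fun_prop
      have h3 := (h2.tendsto 0).mono_left (nhdsWithin_le_nhds (s := Set.Ioi 0))
      have h4 : exp (σ * t) * recipWeight ε 0 t = exp ((σ - ε) * t) := by
        rw [recipWeight, zero_mul, add_zero, ← exp_add]
        congr 1
        ring
      rwa [h4] at h3
    exact ge_of_tendsto hlim (eventually_nhdsWithin_of_forall hδ)
  refine ⟨ε, K 0, hε, sqrt_nonneg _, fun B u f hu ⟨C, σ, hC⟩ => ?_⟩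
  have hC0 : 0 ≤ C := by simpa [hu.eq_zero 0 le_rfl] using hC 0 le_rfl
  have descend : ∀ n : ℕ, (∃ C, ∀ t, 0 ≤ t → ‖u t‖ ≤ C * exp (n * ε * t)) →
      ∃ C, ∀ t, 0 ≤ t → ‖u t‖ ≤ C * exp (0 * t) := by
    intro n
    induction n with
    | zero => rintro ⟨C, h1⟩; exact ⟨C, by simpa using h1⟩
    | succ n ih =>
      rintro ⟨C, h1⟩
      refine ih ⟨K ((n + 1 : ℕ) * ε) * B, fun t ht => ?_⟩
      have h2 := step B u f hu ((n + 1 : ℕ) * ε) (by positivity) C h1 t ht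
      rwa [show ((n + 1 : ℕ) : ℝ) * ε - ε = n * ε by push_cast; ring] at h2
  obtain ⟨n, hn⟩ := exists_nat_ge (σ / ε)
  obtain ⟨C', hC'⟩ := descend n ⟨C, fun t ht => (hC t ht).trans
    (mul_le_mul_of_nonneg_left (exp_le_exp.mpr
      (mul_le_mul_of_nonneg_right ((div_le_iff₀ hε).mp hn) ht)) hC0)⟩
  intro t ht
  have := step B u f hu 0 le_rfl C' hC' t ht
  rwa [zero_sub] at this

end

section

/-! ### Reduction of the initial value problem to the forced equation -/

section

variable {E : Type*} [NormedAddCommGroup E]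

theorem norm_le_sSup_of_continuousOn {φ : ℝ → E} {h : ℝ}
    (hφ : ContinuousOn φ (Set.Icc (-h) 0)) {s : ℝ} (hs : s ∈ Set.Icc (-h) 0) :
    ‖φ s‖ ≤ sSup ((fun s => ‖φ s‖) '' Set.Icc (-h) 0) :=
  le_csSup (isCompact_Icc.bddAbove_image hφ.norm) (Set.mem_image_of_mem _ hs)

variable [NormedSpace ℝ E]

theorem norm_sum_apply_le_of_le {r : ℕ} (A : Fin r → E →L[ℝ] E) (x : Fin r → E) {m : ℝ}
    (hx : ∀ i, ‖x i‖ ≤ m) : ‖∑ i, A i (x i)‖ ≤ (∑ i, ‖A i‖) * m := by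
  rw [Finset.sum_mul]
  exact norm_sum_le_of_le _ fun i _ => ((A i).le_opNorm _).trans
    (mul_le_mul_of_nonneg_left (hx i) (norm_nonneg _))

/-- Over a time step `a` with `a ∑ᵢ ‖Aᵢ‖ ≤ 1 / 2`, the supremum of a solution at most doubles. -/
theorem IsDelaySolution.doubling {r : ℕ} {A : Fin r → E →L[ℝ] E} {τ : Fin r → ℝ} {h : ℝ}
    {φ v : ℝ → E} (hv : IsDelaySolution A τ h φ v) (hh : 0 ≤ h)
    (hτ : ∀ i, 0 ≤ τ i ∧ τ i ≤ h) {a b S : ℝ} (ha : 0 < a) (haA : (∑ i, ‖A i‖) * a ≤ 1 / 2)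
    (hb : 0 ≤ b) (hS : ∀ t ∈ Set.Icc (-h) b, ‖v t‖ ≤ S) :
    ∀ t ∈ Set.Icc (-h) (b + a), ‖v t‖ ≤ 2 * S := by
  obtain ⟨-, hcont, hderiv⟩ := hv
  have hS0 : 0 ≤ S := (norm_nonneg _).trans (hS 0 ⟨by linarith, hb⟩)
  obtain ⟨t₀, ht₀, hmax⟩ := isCompact_Icc.exists_isMaxOn
    (Set.nonempty_Icc.mpr (by linarith : -h ≤ b + a))
    ((hcont.mono Set.Icc_subset_Ici_self).norm (s := Set.Icc (-h) (b + a)))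
  suffices hm : ‖v t₀‖ ≤ 2 * S from fun t ht => (hmax ht).trans hm
  rcases le_or_gt t₀ b with h1 | h1
  · linarith [hS t₀ ⟨ht₀.1, h1⟩]
  · have h2 := norm_image_sub_le_of_norm_deriv_le_segment' (f := v) (a := b) (b := b + a)
      (f' := fun t => ∑ i, A i (v (t - τ i))) (C := (∑ i, ‖A i‖) * ‖v t₀‖)
      (fun x hx => (hderiv x (hb.trans hx.1)).mono fun y hy => hb.trans hy.1)
      (fun x hx => norm_sum_apply_le_of_le A _ fun i => hmax
        ⟨by linarith [(hτ i).2, hx.1], by linarith [(hτ i).1, hx.2]⟩) t₀ ⟨h1.le, ht₀.2⟩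
    have h3 : ‖v t₀‖ ≤ ‖v b‖ + ‖v t₀ - v b‖ := by
      have := norm_add_le (v b) (v t₀ - v b)
      rwa [add_sub_cancel] at this
    have h4 := hS b ⟨by linarith, le_rfl⟩
    have h5 : (∑ i, ‖A i‖) * ‖v t₀‖ * (t₀ - b) ≤ (∑ i, ‖A i‖) * ‖v t₀‖ * a :=
      mul_le_mul_of_nonneg_left (by linarith [ht₀.2])
        (mul_nonneg (Finset.sum_nonneg fun i _ => norm_nonneg _) (norm_nonneg _))
    have h6 := mul_le_mul_of_nonneg_right haA (norm_nonneg (v t₀))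
    linarith

/-- A priori exponential bound for solutions, in terms of the supremum of the initial value. -/
theorem exists_exponential_growth_bound {r : ℕ} (A : Fin r → E →L[ℝ] E) {τ : Fin r → ℝ} {h : ℝ}
    (hh : 0 ≤ h) (hτ : ∀ i, 0 ≤ τ i ∧ τ i ≤ h) :
    ∃ κ : ℝ, 0 ≤ κ ∧ ∀ φ v : ℝ → E, ContinuousOn φ (Set.Icc (-h) 0) →
      IsDelaySolution A τ h φ v → ∀ T, 0 ≤ T → ∀ t ∈ Set.Icc (-h) T,
      ‖v t‖ ≤ 2 * sSup ((fun s => ‖φ s‖) '' Set.Icc (-h) 0) * exp (κ * T) := by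
  have hA0 : 0 ≤ ∑ i, ‖A i‖ := Finset.sum_nonneg fun i _ => norm_nonneg _
  set a : ℝ := 1 / (2 * (∑ i, ‖A i‖ + 1)) with ha
  have ha0 : 0 < a := by positivity
  have haA : (∑ i, ‖A i‖) * a ≤ 1 / 2 := by
    rw [ha, mul_one_div, div_le_div_iff₀ (by positivity) two_pos]
    linarith
  refine ⟨log 2 / a, by positivity, fun φ v hφ hv T hT t ht => ?_⟩
  set S := sSup ((fun s => ‖φ s‖) '' Set.Icc (-h) 0) with hS
  have hS0 : 0 ≤ S := (norm_nonneg _).trans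
    (norm_le_sSup_of_continuousOn hφ ⟨by linarith, le_rfl⟩)
  have hn : ∀ n : ℕ, ∀ t ∈ Set.Icc (-h) (n * a), ‖v t‖ ≤ 2 ^ n * S := by
    intro n
    induction n with
    | zero =>
      intro t ht
      have ht' : t ∈ Set.Icc (-h) 0 := by simpa using ht
      rw [hv.1 ht', pow_zero, one_mul]
      exact norm_le_sSup_of_continuousOn hφ ht'
    | succ n ih =>
      intro t ht
      rw [pow_succ', mul_assoc]
      refine hv.doubling hh hτ ha0 haA (b := n * a) (by positivity) ih t ⟨ht.1, ht.2.trans ?_⟩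
      push_cast
      linarith
  have h1 : T ≤ ⌈T / a⌉₊ * a := (div_le_iff₀ ha0).mp (Nat.le_ceil _)
  have h2 : (2 : ℝ) ^ ⌈T / a⌉₊ ≤ 2 * exp (log 2 / a * T) := by
    have h3 : (⌈T / a⌉₊ : ℝ) ≤ T / a + 1 := (Nat.ceil_lt_add_one (by positivity)).le
    calc (2 : ℝ) ^ ⌈T / a⌉₊ = exp (⌈T / a⌉₊ * log 2) := by
          rw [exp_nat_mul, exp_log two_pos]
      _ ≤ exp ((T / a + 1) * log 2) := by gcongr
      _ = 2 * exp (log 2 / a * T) := by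
          rw [add_mul, one_mul, exp_add, exp_log two_pos, mul_comm]
          congr 2
          ring
  calc ‖v t‖ ≤ 2 ^ ⌈T / a⌉₊ * S := hn _ t ⟨ht.1, ht.2.trans h1⟩
    _ ≤ (2 * exp (log 2 / a * T)) * S := mul_le_mul_of_nonneg_right h2 hS0
    _ = _ := by ring

/-- The product of a scalar function that vanishes to first order and a continuous function has
derivative zero. -/
theorem hasDerivAt_smul_of_vanishing {χ : ℝ → ℝ} {v : ℝ → E} {t : ℝ} (h0 : χ t = 0)
    (hχ : HasDerivAt χ 0 t) (hv : ContinuousAt v t) : HasDerivAt (fun s => χ s • v s) 0 t := by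
  rw [hasDerivAt_iff_isLittleO] at hχ ⊢
  simp only [h0, smul_zero, sub_zero, zero_smul] at hχ ⊢
  simpa using hχ.smul_isBigO (hv.norm.isBoundedUnder_le.isBigO_one ℝ)

theorem deriv_smoothTransition_of_nonpos {t : ℝ} (ht : t ≤ 0) :
    deriv smoothTransition t = 0 := by
  refine IsLocalMin.deriv_eq_zero (Eventually.of_forall fun s => ?_)
  rw [smoothTransition.zero_of_nonpos ht]
  exact smoothTransition.nonneg s

theorem deriv_smoothTransition_of_one_le {t : ℝ} (ht : 1 ≤ t) :
    deriv smoothTransition t = 0 := by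
  refine IsLocalMax.deriv_eq_zero (Eventually.of_forall fun s => ?_)
  rw [smoothTransition.one_of_one_le ht]
  exact smoothTransition.le_one s

theorem hasDerivAt_smoothTransition (t : ℝ) :
    HasDerivAt smoothTransition (deriv smoothTransition t) t :=
  ((smoothTransition.contDiff (n := 1)).differentiable one_ne_zero t).hasDerivAt

theorem continuous_deriv_smoothTransition : Continuous (deriv smoothTransition) :=
  (smoothTransition.contDiff (n := 1)).continuous_deriv le_rfl

theorem exists_norm_deriv_smoothTransition_le :
    ∃ C, 0 ≤ C ∧ ∀ t, ‖deriv smoothTransition t‖ ≤ C := by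
  obtain ⟨C, hC⟩ := (isCompact_Icc (a := (0 : ℝ)) (b := 1)).exists_bound_of_continuousOn
    continuous_deriv_smoothTransition.continuousOn
  have hC0 : 0 ≤ C := (norm_nonneg _).trans (hC 0 (by simp))
  refine ⟨C, hC0, fun t => ?_⟩
  rcases le_total t 0 with h1 | h1
  · rwa [deriv_smoothTransition_of_nonpos h1, norm_zero]
  rcases le_total 1 t with h2 | h2
  · rwa [deriv_smoothTransition_of_one_le h2, norm_zero]
  · exact hC t ⟨h1, h2⟩

end

variable {E : Type*} [NormedAddCommGroup E] [InnerProductSpace ℝ E]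

/-- Cutting a solution off smoothly at the initial time gives a forced solution with zero history,
whose forcing is controlled by the solution on `[-h, 1 + h]`. The solution is extended
continuously to the left of `-h`, where the given function carries no information. -/
theorem IsDelaySolution.isForcedSolution {r : ℕ} {A : Fin r → E →L[ℝ] E} {τ : Fin r → ℝ}
    {h C m : ℝ} {φ v : ℝ → E} (hv : IsDelaySolution A τ h φ v) (hh : 0 ≤ h)
    (hτ : ∀ i, 0 ≤ τ i ∧ τ i ≤ h) (hC : ∀ t, ‖deriv smoothTransition t‖ ≤ C)
    (hm : ∀ t ∈ Set.Icc (-h) (1 + h), ‖v t‖ ≤ m) :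
    ∃ f, IsForcedSolution A τ (1 + h) ((C + ∑ i, ‖A i‖) * m)
      (fun t => smoothTransition t • v (max t (-h))) f := by
  obtain ⟨-, hcont, hderiv⟩ := hv
  set χ := smoothTransition with hχ
  let vb : ℝ → E := fun t => v (max t (-h))
  have hvb : Continuous vb :=
    hcont.comp_continuous (by fun_prop) fun t => Set.mem_Ici.mpr (le_max_right _ _)
  have hvbeq : ∀ t, -h ≤ t → vb t = v t := fun t ht => by simp only [vb, max_eq_left ht]
  have hχc : Continuous χ := smoothTransition.continuous
  let f : ℝ → E := fun t => deriv χ t • vb t + ∑ i, A i ((χ t - χ (t - τ i)) • vb (t - τ i))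
  have hC0 : 0 ≤ C := (norm_nonneg _).trans (hC 0)
  have hm0 : 0 ≤ m := (norm_nonneg _).trans (hm 0 ⟨by linarith, by linarith⟩)
  have hfzero : ∀ t, t ∉ Set.Icc 0 (1 + h) → f t = 0 := by
    intro t ht
    rcases lt_or_ge t 0 with h1 | h1
    · simp only [f]
      rw [deriv_smoothTransition_of_nonpos h1.le, zero_smul, zero_add]
      refine Finset.sum_eq_zero fun i _ => ?_
      rw [hχ, smoothTransition.zero_of_nonpos h1.le,
        smoothTransition.zero_of_nonpos (by linarith [(hτ i).1])]
      simp
    · have h2 : 1 + h < t := not_le.mp fun h2 => ht ⟨h1, h2⟩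
      simp only [f]
      rw [deriv_smoothTransition_of_one_le (by linarith), zero_smul, zero_add]
      refine Finset.sum_eq_zero fun i _ => ?_
      rw [hχ, smoothTransition.one_of_one_le (by linarith),
        smoothTransition.one_of_one_le (by linarith [(hτ i).2])]
      simp
  have hfzero0 : ∀ t ≤ 0, f t = 0 := by
    intro t ht
    simp only [f]
    rw [deriv_smoothTransition_of_nonpos ht, zero_smul, zero_add]
    refine Finset.sum_eq_zero fun i _ => ?_
    rw [hχ, smoothTransition.zero_of_nonpos ht,
      smoothTransition.zero_of_nonpos (by linarith [(hτ i).1])]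
    simp
  refine ⟨f, ⟨fun t => ?_, fun t ht => ?_, ?_, fun t => ?_, hfzero⟩⟩
  · rcases le_or_gt t 0 with ht | ht
    · have h1 : ∑ i, A i (χ (t - τ i) • v (max (t - τ i) (-h))) = 0 :=
        Finset.sum_eq_zero fun i _ => by
          rw [hχ, smoothTransition.zero_of_nonpos (by linarith [(hτ i).1]), zero_smul, map_zero]
      simp only [h1, hfzero0 t ht, add_zero]
      refine hasDerivAt_smul_of_vanishing (smoothTransition.zero_of_nonpos ht) ?_
        hvb.continuousAt
      have := hasDerivAt_smoothTransition t
      rwa [deriv_smoothTransition_of_nonpos ht] at this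
    · have h1 : HasDerivAt vb (∑ i, A i (v (t - τ i))) t := by
        refine ((hderiv t ht.le).hasDerivAt (Ici_mem_nhds ht)).congr_of_eventuallyEq ?_
        filter_upwards [Ioi_mem_nhds ht] with s hs
        exact hvbeq s (by linarith [Set.mem_Ioi.mp hs])
      refine ((hasDerivAt_smoothTransition t).smul h1).congr_deriv ?_
      simp only [f, map_smul, map_sub, sub_smul, Finset.sum_sub_distrib, Finset.smul_sum]
      have h2 : ∀ i, vb (t - τ i) = v (t - τ i) := fun i => hvbeq _ (by linarith [(hτ i).2])
      change ∑ i, χ t • A i (v (t - τ i)) + deriv χ t • vb t =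
        ∑ i, χ (t - τ i) • A i (vb (t - τ i)) + _
      simp only [h2]
      abel
  · rw [hχ, smoothTransition.zero_of_nonpos ht, zero_smul]
  · refine (continuous_deriv_smoothTransition.smul hvb).add (continuous_finsetSum _ fun i _ => ?_)
    refine (A i).continuous.comp ((hχc.sub (hχc.comp (by fun_prop))).smul
      (hvb.comp (by fun_prop)))
  · by_cases ht : t ∈ Set.Icc 0 (1 + h)
    · have h1 : ∀ s, -h ≤ s → s ≤ 1 + h → ‖vb s‖ ≤ m := fun s hs hs' => by
        rw [hvbeq s hs]; exact hm s ⟨hs, hs'⟩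
      rw [add_mul]
      refine norm_add_le_of_le ?_ (norm_sum_apply_le_of_le A _ fun i => ?_)
      · rw [norm_smul]
        exact mul_le_mul (hC t) (h1 t (by linarith [ht.1]) ht.2) (norm_nonneg _) hC0
      · rw [norm_smul]
        refine (mul_le_of_le_one_left (norm_nonneg _) ?_).trans
          (h1 _ (by linarith [(hτ i).2, ht.1]) (by linarith [(hτ i).1, ht.2]))
        rw [norm_eq_abs, abs_le]
        constructor <;> linarith [smoothTransition.nonneg t, smoothTransition.le_one t,
          smoothTransition.nonneg (t - τ i), smoothTransition.le_one (t - τ i)]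
    · rw [hfzero t ht, norm_zero]
      exact mul_nonneg (add_nonneg hC0 (Finset.sum_nonneg fun i _ => norm_nonneg _)) hm0

/-- Sufficiency of the delay bound `l h < π / 2` for exponential stability, for symmetric negative
semidefinite coefficients. -/
theorem IsDissipative.isGloballyExpStable [FiniteDimensional ℝ E] {r : ℕ}
    {A : Fin r → E →L[ℝ] E} {μ l h : ℝ} (hA : IsDissipative A μ l) (hμ : 0 < μ) (hl : 0 ≤ l)
    (hh : 0 ≤ h) (hlh : l * h < π / 2) (τ : Fin r → ℝ) (hτ : ∀ i, 0 ≤ τ i ∧ τ i ≤ h) :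
    IsGloballyExpStable A τ h := by
  obtain ⟨ε, K, hε, hK, hdecay⟩ := hA.exists_decay hμ hl hh hlh τ hτ
    (L := 1 + h) (by linarith)
  obtain ⟨κ, hκ, hgrowth⟩ := exists_exponential_growth_bound A hh hτ
  obtain ⟨C, hC0, hC⟩ := exists_norm_deriv_smoothTransition_le
  have hA0 : 0 ≤ ∑ i, ‖A i‖ := Finset.sum_nonneg fun i _ => norm_nonneg _
  refine ⟨K * ((C + ∑ i, ‖A i‖) * (2 * exp (κ * (1 + h)))) + 2 * exp κ * exp ε, ε,
    by positivity, hε, fun φ hφ v hv t ht => ?_⟩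
  set S := sSup ((fun s => ‖φ s‖) '' Set.Icc (-h) 0) with hS
  have hS0 : 0 ≤ S := (norm_nonneg _).trans
    (norm_le_sSup_of_continuousOn hφ ⟨by linarith, le_rfl⟩)
  have hg := hgrowth φ v hφ hv
  rw [← hS] at hg
  rcases le_or_gt t 1 with h1 | h1
  · have h2 := hg 1 zero_le_one t ⟨by linarith, h1⟩
    have h3 : 1 ≤ exp ε * exp (-ε * t) := by
      rw [← exp_add, one_le_exp_iff]
      nlinarith
    calc ‖v t‖ ≤ 2 * S * exp (κ * 1) * 1 := by rwa [mul_one]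
      _ ≤ 2 * S * exp (κ * 1) * (exp ε * exp (-ε * t)) := by gcongr
      _ = (0 + 2 * exp κ * exp ε) * exp (-ε * t) * S := by rw [mul_one]; ring
      _ ≤ _ := by gcongr; positivity
  · obtain ⟨f, hf⟩ := hv.isForcedSolution hh hτ hC (hg (1 + h) (by linarith))
    have h2 := hdecay _ _ _ hf ⟨2 * S, κ, fun s hs => ?_⟩ t ht
    · simp only [smoothTransition.one_of_one_le h1.le, one_smul,
        max_eq_left (by linarith : -h ≤ t)] at h2
      calc ‖v t‖ ≤ _ := h2
        _ = (K * ((C + ∑ i, ‖A i‖) * (2 * exp (κ * (1 + h)))) + 0) * exp (-ε * t) * S := by ring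
        _ ≤ _ := by gcongr; positivity
    · rw [norm_smul, norm_of_nonneg (smoothTransition.nonneg s),
        max_eq_left (by linarith : -h ≤ s)]
      exact (mul_le_of_le_one_left (norm_nonneg _) (smoothTransition.le_one s)).trans
        (hg s hs s ⟨by linarith, le_rfl⟩)

end

/-! ### The Laplacians as quadratic forms -/

theorem inner_lapH1 {N d : ℕ} (w : Fin N → Fin N → ℝ) (hw : ∀ x y, w x y = w y x)
    (f g : H1 N d) : inner ℝ (lapH1 w hw d f) g =
      -(1 / 2) * ∑ x, ∑ y, w x y *
        inner ℝ (f.1 y - f.1 x) (g.1 y - g.1 x) := by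
  set F : L2 N d := f.1
  set G : L2 N d := g.1
  have h1 : inner ℝ (lapH1 w hw d f) g = ∑ x, ∑ y, w x y * inner ℝ (F y - F x) (G x) := by
    change inner ℝ (lap w d F) G = _
    rw [L2.inner_eq]
    refine Finset.sum_congr rfl fun x _ => ?_
    rw [lap_apply, sum_inner]
    refine Finset.sum_congr rfl fun y _ => ?_
    rw [real_inner_smul_left]
  -- exchanging the names of the two nodes flips the sign
  have h2 : ∑ x, ∑ y, w x y * inner ℝ (F y - F x) (G x) =
      -∑ x, ∑ y, w x y * inner ℝ (F y - F x) (G y) := by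
    rw [Finset.sum_comm]
    simp only [← Finset.sum_neg_distrib]
    refine Finset.sum_congr rfl fun x _ => Finset.sum_congr rfl fun y _ => ?_
    rw [hw y x, ← neg_sub (F y) (F x), inner_neg_left]
    ring
  have h3 : ∑ x, ∑ y, w x y * inner ℝ (F y - F x) (G y - G x) =
      ∑ x, ∑ y, w x y * inner ℝ (F y - F x) (G y) -
      ∑ x, ∑ y, w x y * inner ℝ (F y - F x) (G x) := by
    simp only [← Finset.sum_sub_distrib, inner_sub_right, mul_sub]
  rw [h3, h1]
  linarith

theorem inner_lapH1_symm {N d : ℕ} (w : Fin N → Fin N → ℝ) (hw : ∀ x y, w x y = w y x)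
    (f g : H1 N d) : inner ℝ (lapH1 w hw d f) g = inner ℝ f (lapH1 w hw d g) := by
  rw [real_inner_comm (lapH1 w hw d g) f, inner_lapH1, inner_lapH1]
  congr 1
  refine Finset.sum_congr rfl fun x _ => Finset.sum_congr rfl fun y _ => ?_
  rw [real_inner_comm]

theorem inner_lapH1_nonpos {N d : ℕ} (w : Fin N → Fin N → ℝ) (hw : ∀ x y, w x y = w y x)
    (h0 : ∀ x y, 0 ≤ w x y) (f : H1 N d) : inner ℝ (lapH1 w hw d f) f ≤ 0 := by
  rw [inner_lapH1]
  have : 0 ≤ ∑ x, ∑ y, w x y *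
      inner ℝ (f.1 y - f.1 x) (f.1 y - f.1 x) :=
    Finset.sum_nonneg fun x _ => Finset.sum_nonneg fun y _ =>
      mul_nonneg (h0 x y) real_inner_self_nonneg
  linarith

/-- On a connected graph the Dirichlet form is definite on functions with zero average. -/
theorem WeightedGraph.inner_laplacian_neg {N d : ℕ} (G : WeightedGraph N)
    (hG : G.graph.Connected) {f : H1 N d} (hf : f ≠ 0) :
    inner ℝ (G.laplacian d f) f < 0 := by
  refine lt_of_le_of_ne (inner_lapH1_nonpos _ _ G.weight_nonneg f) fun h => hf ?_
  set F : L2 N d := f.1 with hF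
  have h1 : ∑ x, ∑ y, G.weight x y * inner ℝ (F y - F x) (F y - F x) = 0 := by
    have h2 : inner ℝ (G.laplacian d f) f = -(1 / 2) * _ :=
      inner_lapH1 G.weight G.weight_symm f f
    rw [h2] at h
    linarith
  have hnn : ∀ x y, 0 ≤ G.weight x y * inner ℝ (F y - F x) (F y - F x) := fun x y =>
    mul_nonneg (G.weight_nonneg x y) real_inner_self_nonneg
  have hadj : ∀ x y, G.graph.Adj x y → F x = F y := by
    intro x y hxy
    have h2 := (Finset.sum_eq_zero_iff_of_nonneg fun x _ =>
      Finset.sum_nonneg fun y _ => hnn x y).mp h1 x (Finset.mem_univ x)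
    have h3 := (Finset.sum_eq_zero_iff_of_nonneg fun y _ => hnn x y).mp h2 y (Finset.mem_univ y)
    have h4 := (G.weight_pos_iff x y).mpr (Or.inr hxy)
    have h5 := (mul_eq_zero.mp h3).resolve_left h4.ne'
    exact (sub_eq_zero.mp (inner_self_eq_zero.mp h5)).symm
  have hconst : ∀ x y, F x = F y := fun x y => by
    obtain ⟨p⟩ := hG.preconnected x y
    induction p with
    | nil => rfl
    | cons h _ ih => exact (hadj _ _ h).trans ih
  have hsum : ∑ x, F x = 0 := f.2
  have hzero : ∀ x, F x = 0 := fun x => by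
    have hN : (N : ℝ) ≠ 0 := by
      have := Fin.pos x
      exact_mod_cast this.ne'
    have h6 : (N : ℝ) • F x = 0 := by
      rw [← hsum, Finset.sum_congr rfl fun y _ => hconst y x]
      simp [Nat.cast_smul_eq_nsmul]
    exact (smul_eq_zero.mp h6).resolve_left hN
  exact Subtype.ext (L2.ext hzero)

theorem WeightedGraph.weight_eq_zero {N : ℕ} (G : WeightedGraph N) {x y : Fin N}
    (h : (x, y) ∉ G.edges) : G.weight x y = 0 :=
  le_antisymm (not_lt.mp fun h1 => h ((G.weight_pos_iff x y).mp h1)) (G.weight_nonneg x y)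

theorem DelayAssignment.weight_nonneg {N r : ℕ} {G : WeightedGraph N} (T : DelayAssignment G r)
    (i : Fin r) (x y : Fin N) : 0 ≤ T.weight i x y := by
  unfold DelayAssignment.weight
  split_ifs
  exacts [G.weight_nonneg x y, le_rfl]

theorem DelayAssignment.sum_weight {N r : ℕ} {G : WeightedGraph N} (T : DelayAssignment G r)
    (x y : Fin N) : ∑ i, T.weight i x y = G.weight x y := by
  by_cases h : (x, y) ∈ G.edges
  · rw [Finset.sum_eq_single (T.toFun ⟨(x, y), h⟩)]
    · exact if_pos ⟨h, rfl⟩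
    · rintro i - hi
      exact if_neg fun ⟨_, h'⟩ => hi h'.symm
    · exact fun h' => absurd (Finset.mem_univ _) h'
  · rw [G.weight_eq_zero h]
    exact Finset.sum_eq_zero fun i _ => if_neg fun ⟨h', _⟩ => h h'

theorem DelayAssignment.sum_inner_laplacian {N d r : ℕ} {G : WeightedGraph N}
    (T : DelayAssignment G r) (f g : H1 N d) :
    ∑ i, inner ℝ (T.laplacian d i f) g = inner ℝ (G.laplacian d f) g := by
  simp only [DelayAssignment.laplacian, WeightedGraph.laplacian, inner_lapH1]
  rw [← Finset.mul_sum, Finset.sum_comm]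
  congr 1
  refine Finset.sum_congr rfl fun x _ => ?_
  rw [Finset.sum_comm]
  refine Finset.sum_congr rfl fun y _ => ?_
  rw [← Finset.sum_mul, T.sum_weight]

theorem DelayAssignment.sum_laplacian {N d r : ℕ} {G : WeightedGraph N}
    (T : DelayAssignment G r) (f : H1 N d) :
    ∑ i, T.laplacian d i f = G.laplacian d f :=
  ext_inner_right ℝ fun g => by rw [sum_inner, T.sum_inner_laplacian]

theorem DelayAssignment.exists_isDissipative {N d r : ℕ} {G : WeightedGraph N}
    (hG : G.graph.Connected) (T : DelayAssignment G r) :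
    ∃ μ, 0 < μ ∧ IsDissipative (T.laplacian d) μ ‖G.laplacian d‖ := by
  obtain ⟨μ, hμ, hlow⟩ : ∃ μ : ℝ, 0 < μ ∧
      ∀ f : H1 N d, μ * ‖f‖ ^ 2 ≤ -inner ℝ (G.laplacian d f) f := by
    -- the spectral gap is the minimum of the Dirichlet form on the unit sphere
    have hcont : Continuous fun f : H1 N d => -inner ℝ (G.laplacian d f) f :=
      ((G.laplacian d).continuous.inner continuous_id).neg
    rcases (Metric.sphere (0 : H1 N d) 1).eq_empty_or_nonempty with he | hne
    · refine ⟨1, one_pos, fun f => ?_⟩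
      have hf : f = 0 := by
        by_contra hf
        have : (‖f‖⁻¹ • f) ∈ Metric.sphere (0 : H1 N d) 1 := by
          rw [mem_sphere_zero_iff_norm, norm_smul, norm_inv, norm_norm,
            inv_mul_cancel₀ (norm_ne_zero_iff.mpr hf)]
        rw [he] at this
        exact this
      simp [hf]
    · obtain ⟨e, he, hmin⟩ := (isCompact_sphere (0 : H1 N d) 1).exists_isMinOn hne
        hcont.continuousOn
      have he0 : e ≠ 0 := ne_zero_of_mem_unit_sphere ⟨e, he⟩
      refine ⟨-inner ℝ (G.laplacian d e) e, neg_pos.mpr (G.inner_laplacian_neg hG he0),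
        fun f => ?_⟩
      by_cases hf : f = 0
      · simp [hf]
      have hn : 0 < ‖f‖ := norm_pos_iff.mpr hf
      have hmem : (‖f‖⁻¹ • f) ∈ Metric.sphere (0 : H1 N d) 1 := by
        rw [mem_sphere_zero_iff_norm, norm_smul, norm_inv, norm_norm, inv_mul_cancel₀ hn.ne']
      have h1 := hmin hmem
      simp only [Set.mem_ofPred_eq, map_smul, real_inner_smul_left, real_inner_smul_right] at h1
      have h2 := mul_le_mul_of_nonneg_right h1 (sq_nonneg ‖f‖)
      refine h2.trans (le_of_eq ?_)
      field_simp
  refine ⟨μ, hμ, fun i x y => inner_lapH1_symm _ _ x y,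
    fun i x => inner_lapH1_nonpos _ _ (T.weight_nonneg i) x, fun x => ?_, fun x => ?_⟩
  · rw [T.sum_inner_laplacian]
    exact hlow x
  · rw [T.sum_inner_laplacian]
    have h1 := abs_le.mp (abs_real_inner_le_norm (G.laplacian d x) x)
    have h2 := mul_le_mul_of_nonneg_right ((G.laplacian d).le_opNorm x) (norm_nonneg x)
    nlinarith [h1.1]

theorem H1.nontrivial {N d : ℕ} (hN : 2 ≤ N) (hd : 1 ≤ d) : Nontrivial (H1 N d) := by
  let e : EuclideanSpace ℝ (Fin d) := EuclideanSpace.single ⟨0, hd⟩ 1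
  have he : e ≠ 0 := by simp [e]
  let a : Fin N := ⟨0, by omega⟩
  let b : Fin N := ⟨1, by omega⟩
  have hab : a ≠ b := by simp [a, b]
  let F : Fin N → EuclideanSpace ℝ (Fin d) := Pi.single a e - Pi.single b e
  have hF : L2.of F ∈ H1 N d := by
    change ∑ x, F x = 0
    simp [F]
  refine ⟨⟨⟨L2.of F, hF⟩, 0, fun h => he ?_⟩⟩
  have h1 : L2.of F = 0 := congrArg Subtype.val h
  have h2 : F a = 0 := by rw [← L2.of_apply F a, h1, L2.zero_apply]
  simpa [F, hab] using h2

/-! ### The extremal eigenvector and the oscillating solution -/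

/-- A symmetric operator `P` with nonpositive form attains `-‖P‖` as an eigenvalue. If `f`
maximizes `‖P f‖` on the unit sphere, then `P² f = ‖P‖² f`, so `g = P f + ‖P‖ f` satisfies
`P g = ‖P‖ g`, and nonpositivity of the form forces `g = 0`. -/
theorem exists_eigenvector_neg_norm {E : Type*} [NormedAddCommGroup E] [InnerProductSpace ℝ E]
    [FiniteDimensional ℝ E] [Nontrivial E] (P : E →L[ℝ] E)
    (hsymm : ∀ x y, inner ℝ (P x) y = inner ℝ x (P y)) (hneg : ∀ x, inner ℝ (P x) x ≤ 0) :
    ∃ f, f ≠ 0 ∧ P f = -(‖P‖ • f) := by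
  obtain ⟨f, hf, hmax⟩ := (isCompact_sphere (0 : E) 1).exists_isMaxOn
    (NormedSpace.sphere_nonempty.mpr zero_le_one) P.continuous.norm.continuousOn
  have hf1 : ‖f‖ = 1 := mem_sphere_zero_iff_norm.mp hf
  have hf0 : f ≠ 0 := ne_zero_of_mem_unit_sphere ⟨f, hf⟩
  have hnorm : ‖P f‖ = ‖P‖ := by
    refine le_antisymm (by simpa [hf1] using P.le_opNorm f) ?_
    exact P.opNorm_le_of_unit_norm (norm_nonneg _) fun x hx =>
      hmax (mem_sphere_zero_iff_norm.mpr hx)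
  set l := ‖P‖ with hl
  have hl0 : 0 ≤ l := norm_nonneg _
  have hPP : P (P f) = l ^ 2 • f := by
    -- `‖P² f - l² f‖² = ‖P² f‖² - 2 l² ‖P f‖² + l⁴ ≤ 0`
    refine sub_eq_zero.mp (norm_eq_zero.mp (sq_eq_zero_iff.mp (le_antisymm ?_ (sq_nonneg _))))
    have h1 : ‖P (P f)‖ ^ 2 ≤ (l * l) ^ 2 :=
      pow_le_pow_left₀ (norm_nonneg _) ((P.le_opNorm _).trans_eq (by rw [hnorm])) 2
    rw [norm_sub_sq_real, real_inner_smul_right, hsymm, real_inner_self_eq_norm_sq, hnorm,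
      norm_smul, norm_pow, norm_of_nonneg hl0, hf1]
    nlinarith
  refine ⟨f, hf0, ?_⟩
  set g := P f + l • f with hg
  have hPg : P g = l • g := by
    rw [hg, map_add, map_smul, hPP]
    module
  have h1 := hneg g
  rw [hPg, real_inner_smul_left, real_inner_self_eq_norm_sq] at h1
  rcases hl0.eq_or_lt with h0 | h0
  · rw [← h0] at hnorm ⊢
    rw [norm_eq_zero.mp hnorm, zero_smul, neg_zero]
  · have h2 : ‖g‖ ^ 2 ≤ 0 := by
      by_contra h3
      exact absurd h1 (not_le.mpr (mul_pos h0 (not_le.mp h3)))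
    have h3 : g = 0 := norm_eq_zero.mp (sq_eq_zero_iff.mp (le_antisymm h2 (sq_nonneg _)))
    exact eq_neg_of_add_eq_zero_left h3

/-- If `∑ᵢ Aᵢ` has an eigenvalue `-l < 0` and all delays equal `π / (2 l)`, then `cos (l t) f` is a
solution, so the equation is not exponentially stable. -/
theorem not_isGloballyExpStable_of_eigenvector {E : Type*} [NormedAddCommGroup E]
    [NormedSpace ℝ E] {r : ℕ} (A : Fin r → E →L[ℝ] E) {l h : ℝ} (hl : 0 < l) {f : E}
    (hf : f ≠ 0) (hAf : ∑ i, A i f = -(l • f)) :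
    ¬ IsGloballyExpStable A (fun _ => π / (2 * l)) h := by
  rintro ⟨M, γ, -, hγ, hstab⟩
  let v : ℝ → E := fun t => cos (l * t) • f
  have hvc : Continuous v := by fun_prop
  have hsol : IsDelaySolution A (fun _ => π / (2 * l)) h v v := by
    refine ⟨fun t _ => rfl, hvc.continuousOn, fun t _ => HasDerivAt.hasDerivWithinAt ?_⟩
    have h1 : HasDerivAt (fun t => cos (l * t)) (-sin (l * t) * l) t := by
      simpa using ((hasDerivAt_id t).const_mul l).cos
    refine (h1.smul_const f).congr_deriv ?_
    simp only [v, map_smul]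
    rw [← Finset.smul_sum, hAf,
      show l * (t - π / (2 * l)) = l * t - π / 2 by field_simp, cos_sub_pi_div_two]
    module
  have hbound := hstab v hvc.continuousOn v hsol
  set S := sSup ((fun s => ‖v s‖) '' Set.Icc (-h) 0)
  -- at the times `2 π n / l` the solution returns to `f`, while the bound tends to zero
  have htend : Tendsto (fun n : ℕ => M * exp (-γ * (2 * π / l * n)) * S) atTop (𝓝 0) := by
    have h1 : Tendsto (fun n : ℕ => -γ * (2 * π / l * n)) atTop atBot := by
      have h2 : 0 < 2 * π / l := by positivity
      exact (tendsto_natCast_atTop_atTop.const_mul_atTop h2).const_mul_atTop_of_neg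
        (neg_neg_of_pos hγ)
    simpa using ((tendsto_exp_atBot.comp h1).const_mul M).mul_const S
  have hle : ∀ n : ℕ, ‖f‖ ≤ M * exp (-γ * (2 * π / l * n)) * S := by
    intro n
    have h1 := hbound (2 * π / l * n) (by positivity)
    have h2 : v (2 * π / l * n) = f := by
      simp only [v]
      rw [show l * (2 * π / l * n) = n * (2 * π) by field_simp, cos_nat_mul_two_pi, one_smul]
    rwa [h2] at h1
  exact hf (norm_le_zero_iff.mp (ge_of_tendsto' htend hle))

end DelayConsensus

end

theorem mainTheorem1 {N d r : ℕ} (hN : 2 ≤ N) (hd : 1 ≤ d)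
    (G : DelayConsensus.WeightedGraph N) (hG : G.graph.Connected)
    (T : DelayConsensus.DelayAssignment G r) (τbar : ℝ) (hτbar : 0 ≤ τbar) :
    (∀ τ : Fin r → ℝ, (∀ i, 0 ≤ τ i ∧ τ i ≤ τbar) →
        DelayConsensus.IsGloballyExpStable (T.laplacian d) τ τbar) ↔
      τbar < Real.pi / (2 * ‖G.laplacian d‖) := by
  have := DelayConsensus.H1.nontrivial hN hd
  have hpos : 0 < ‖G.laplacian d‖ := by
    obtain ⟨f, hf⟩ := exists_ne (0 : DelayConsensus.H1 N d)
    refine lt_of_le_of_ne (G.laplacian d).opNorm_nonneg fun h => ?_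
    have h0 := (G.laplacian d).le_opNorm f
    rw [← h, zero_mul] at h0
    have h1 := G.inner_laplacian_neg hG hf
    rw [norm_le_zero_iff.mp h0, inner_zero_left] at h1
    exact lt_irrefl _ h1
  constructor
  · intro h
    by_contra hle
    obtain ⟨f, hf, hPf⟩ := DelayConsensus.exists_eigenvector_neg_norm (G.laplacian d)
      (DelayConsensus.inner_lapH1_symm _ _)
      (DelayConsensus.inner_lapH1_nonpos _ _ G.weight_nonneg)
    exact DelayConsensus.not_isGloballyExpStable_of_eigenvector (T.laplacian d) hpos hf
      ((T.sum_laplacian f).trans hPf)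
      (h _ fun _ => ⟨div_nonneg Real.pi_pos.le (by positivity), not_lt.mp hle⟩)
  · intro h τ hτ
    obtain ⟨μ, hμ, hA⟩ := T.exists_isDissipative (d := d) hG
    refine hA.isGloballyExpStable hμ hpos.le hτbar ?_ τ hτ
    rw [lt_div_iff₀ (by positivity)] at h
    linarith
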